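/- All rings are commutative, and local rings are Noetherian. Let $(R,\mathfrak m)$ be a local ring of Krull dimension $d$. A maximal Cohen--Macaulay (MCM) $R$-module is a nonzero finitely generated $R$-module whose depth equals $d$; the ring $R$ is Cohen--Macaulay (CM) if it is an MCM module over itself. The multiplicity of a finitely generated $R$-module $M$ is $e(M)=\lim_{n\to\infty} d!\,\mathrm{length}_R(M/\mathfrak m^nM)/n^d$. A CM local ring $R$ has bounded CM type if there is an integer $B$ such that $e(M)\le B$ for every indecomposable MCM $R$-module $M$. **Proposition.** Let $R$ be a CM local ring with Henselization $R^{\mathrm h}$ (the universal Henselian local ring receiving a local homomorphism from $R$; it is again a CM local ring). Assume that $R^{\mathrm h}$ is Gorenstein on the punctured spectrum, that is, the localization $(R^{\mathrm h})_{\mathfrak p}$ is a Gorenstein ring for every non-maximal prime ideal $\mathfrak p$ of $R^{\mathrm h}$. If $R$ has bounded CM type, then $R^{\mathrm h}$ has bounded CM type. -/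

import Mathlib

universe u v

noncomputable section

namespace BoundedCM

open IsLocalRing Filter
open scoped ENNReal Nat

/-- `S` is a Henselization of the local ring `R`: `S` is a Henselian local ring, `R → S` is a local
homomorphism, and it is universal among local homomorphisms from `R` to Henselian local rings. This
determines `S` up to a unique isomorphism over `R`. (A Henselization of `R` always exists in the
universe of `R`, so quantifying over the rings `T` of that universe is no restriction.) -/
structure IsHenselization (R S : Type u) [CommRing R] [IsLocalRing R] [CommRing S] [Algebra R S] :
    Prop where
  henselianLocalRing : HenselianLocalRing S
  isLocalHom : IsLocalHom (algebraMap R S)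
  existsUnique_lift : ∀ (T : Type u) [CommRing T] [HenselianLocalRing T] (f : R →+* T),
    IsLocalHom f → ∃! g : S →+* T, IsLocalHom g ∧ g.comp (algebraMap R S) = f

/-- The depth of a module `M` over a local ring `(R, 𝔪)`: the supremum of the lengths of the
`M`-regular sequences in `𝔪`. -/
def depth (R : Type u) [CommRing R] [IsLocalRing R] (M : Type v) [AddCommGroup M] [Module R M] :
    ℕ∞ :=
  ⨆ (rs : List R) (_ : (∀ r ∈ rs, r ∈ maximalIdeal R) ∧ RingTheory.Sequence.IsRegular M rs),
    (rs.length : ℕ∞)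

/-- `M` is a maximal Cohen–Macaulay (MCM) module over the local ring `R`: a nonzero finitely
generated module whose depth equals the Krull dimension of `R`. -/
structure IsMCM (R : Type u) [CommRing R] [IsLocalRing R] (M : Type v) [AddCommGroup M]
    [Module R M] : Prop where
  finite : Module.Finite R M
  nontrivial : Nontrivial M
  depth_eq : (depth R M : WithBot ℕ∞) = ringKrullDim R

/-- `R` is a Cohen–Macaulay local ring: a Noetherian local ring with `depth R = dim R`. -/
structure IsCMLocalRing (R : Type u) [CommRing R] [IsLocalRing R] : Prop where
  noetherian : IsNoetherianRing R
  depth_eq : (depth R R : WithBot ℕ∞) = ringKrullDim R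

/-- `M` is indecomposable: nonzero, and not the direct sum of two nonzero submodules. -/
def IsIndecomposable (R : Type u) [CommRing R] (M : Type v) [AddCommGroup M] [Module R M] : Prop :=
  Nontrivial M ∧ ∀ N P : Submodule R M, IsCompl N P → N = ⊥ ∨ P = ⊥

/-- The Krull dimension of a local ring as a natural number (it is finite when `R` is
Noetherian). -/
def dim (R : Type u) [CommRing R] : ℕ := ((ringKrullDim R).unbotD 0).toNat

/-- The (Hilbert–Samuel) multiplicity of a module `M` over a `d`-dimensional local ring `(R, 𝔪)`,
`e(M) = lim_n d! · length(M / 𝔪ⁿ M) / n ^ d`. For a finitely generated module over a Noetherian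
local ring this limit exists (and is a natural number), so it is equal to the `limsup` that is used
here; for a maximal Cohen–Macaulay module `M` we have `dim M = d`. -/
def hsMultiplicity (R : Type u) [CommRing R] [IsLocalRing R] (M : Type v) [AddCommGroup M]
    [Module R M] : ℝ≥0∞ :=
  limsup (fun n : ℕ => ((dim R)! : ℝ≥0∞) *
    (Module.length R (M ⧸ (maximalIdeal R ^ n • ⊤ : Submodule R M)) : ℝ≥0∞) /
      (n : ℝ≥0∞) ^ dim R) atTop

/-- `R` has bounded CM type: there is a bound on the multiplicities of the indecomposable
maximal Cohen–Macaulay `R`-modules. (Finitely generated `R`-modules all have isomorphic copies in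
the universe of `R`.) -/
def HasBoundedCMType (R : Type u) [CommRing R] [IsLocalRing R] : Prop :=
  ∃ B : ℕ, ∀ (M : Type u) [AddCommGroup M] [Module R M],
    IsMCM R M → IsIndecomposable R M → hsMultiplicity R M ≤ B

/-- `R` is a Gorenstein local ring: a Noetherian local ring of finite injective dimension as a
module over itself. -/
structure IsGorensteinLocalRing (R : Type u) [CommRing R] : Prop where
  isLocalRing : IsLocalRing R
  noetherian : IsNoetherianRing R
  finite_injectiveDimension :
    ∃ n : ℕ, CategoryTheory.HasInjectiveDimensionLE (ModuleCat.of R R) n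

/-- The local ring `(R, 𝔪)` is Gorenstein on the punctured spectrum: `R_𝔭` is Gorenstein for every
prime ideal `𝔭 ≠ 𝔪`. -/
def IsGorensteinOnPuncturedSpectrum (R : Type u) [CommRing R] [IsLocalRing R] : Prop :=
  ∀ (p : Ideal R) [p.IsPrime], p ≠ maximalIdeal R →
    IsGorensteinLocalRing (Localization.AtPrime p)

end BoundedCM

end

/-! Write `S` for the Henselization, `d` for the common dimension, `𝔪` for the maximal ideal of `R`.
An indecomposable MCM `S`-module `M` is shown to be a direct summand of `S ⊗[R] W'` for some
indecomposable MCM `R`-module `W'`. Since `𝔪S` is the maximal ideal of `S` and `S` is flat, base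
change preserves lengths, so `e(M) ≤ e(S ⊗ W') ≤ e(W')`, and a bound for `R` also bounds `S`.

Without regard to depth, such a summand always exists. Every element of `S` comes from an étale
`R`-algebra, so `M` comes from a module `N` over an étale algebra `E`. As `E` is unramified, `E ⊗[R]
N → N` splits over `E`, and a finite `R`-submodule of `N` suffices after extension to `S`
(`exists_isRetract_tensorProduct`).

The Gorenstein hypothesis repairs the depth. It gives `Ext^i(M_p, S_p) = 0` for `i ≥ 1` and `p`
non-maximal (`extZero_localization_of_depthGE`). Under this vanishing, a module of positive depth
embeds in a free module with a cokernel satisfying the same vanishing (`exists_pushforward`), and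
depth drops by at most one. After `d` such steps the cokernel is a summand of some `S ⊗ Y`. Taking
`d` syzygies over `R` recovers depth `d`, and Schanuel's lemma transports the summand relation back
to `M` at the cost of free summands (`exists_isRetract_tensorProduct_depthGE`).

Finally, `S` is Henselian, so indecomposable finite modules satisfy a local endomorphism condition.
Splitting `W` into summands therefore leaves `M` as a summand of the extension of an indecomposable
one.

The required properties of `S` (Noetherian, flat, same dimension, Cohen–Macaulay) are derived from
the universal property, by comparing `S` with its étale local subrings and with the completion of
`R`. -/

namespace BoundedCM
open IsLocalRing
open Polynomial TensorProduct

/-! ### Étale elements and the Henselization. -/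

section EtaleElements

variable {R S : Type u} [CommRing R] [CommRing S] [Algebra R S]

/-- An element of an `R`-algebra is étale if it lies in the image of an étale `R`-algebra. -/
def IsEtaleElement (R : Type u) {S : Type u} [CommRing R] [CommRing S] [Algebra R S] (a : S) :
    Prop :=
  ∃ (E : Type u) (_ : CommRing E) (_ : Algebra R E) (_ : Algebra.Etale R E) (ψ : E →ₐ[R] S),
    a ∈ ψ.range

lemma exists_etale_le_range {E₁ E₂ : Type u} [CommRing E₁] [CommRing E₂] [Algebra R E₁]
    [Algebra R E₂] [Algebra.Etale R E₁] [Algebra.Etale R E₂] (ψ₁ : E₁ →ₐ[R] S) (ψ₂ : E₂ →ₐ[R] S) :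
    ∃ (E : Type u) (_ : CommRing E) (_ : Algebra R E) (_ : Algebra.Etale R E) (ψ : E →ₐ[R] S),
      ψ₁.range ≤ ψ.range ∧ ψ₂.range ≤ ψ.range := by
  refine ⟨E₁ ⊗[R] E₂, inferInstance, inferInstance, Algebra.Etale.comp R E₁ _,
    Algebra.TensorProduct.productMap ψ₁ ψ₂, ?_, ?_⟩
  · rintro _ ⟨x, rfl⟩
    exact ⟨x ⊗ₜ 1, by simp⟩
  · rintro _ ⟨x, rfl⟩
    exact ⟨1 ⊗ₜ x, by simp⟩

lemma exists_etale_forall_mem_range (s : Finset S) (hs : ∀ a ∈ s, IsEtaleElement R a) :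
    ∃ (E : Type u) (_ : CommRing E) (_ : Algebra R E) (_ : Algebra.Etale R E) (ψ : E →ₐ[R] S),
      ∀ a ∈ s, a ∈ ψ.range := by
  classical
  induction s using Finset.induction_on with
  | empty => exact ⟨R, inferInstance, inferInstance, inferInstance, Algebra.ofId R S, by simp⟩
  | insert a s _ ih =>
    obtain ⟨E₁, _, _, _, ψ₁, h₁⟩ := ih fun b hb ↦ hs b (Finset.mem_insert_of_mem hb)
    obtain ⟨E₂, _, _, _, ψ₂, h₂⟩ := hs a (Finset.mem_insert_self a s)
    obtain ⟨E, _, _, _, ψ, hle₁, hle₂⟩ := exists_etale_le_range ψ₁ ψ₂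
    refine ⟨E, inferInstance, inferInstance, inferInstance, ψ, fun b hb ↦ ?_⟩
    obtain rfl | hb := Finset.mem_insert.mp hb
    exacts [hle₂ h₂, hle₁ (h₁ b hb)]

variable (R S) in
/-- The subalgebra of étale elements. -/
def etaleSubalgebra : Subalgebra R S where
  carrier := {a | IsEtaleElement R a}
  mul_mem' {a b} := by
    rintro ⟨E₁, _, _, _, ψ₁, h₁⟩ ⟨E₂, _, _, _, ψ₂, h₂⟩
    obtain ⟨E, _, _, _, ψ, hle₁, hle₂⟩ := exists_etale_le_range ψ₁ ψ₂
    exact ⟨E, inferInstance, inferInstance, inferInstance, ψ, mul_mem (hle₁ h₁) (hle₂ h₂)⟩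
  add_mem' {a b} := by
    rintro ⟨E₁, _, _, _, ψ₁, h₁⟩ ⟨E₂, _, _, _, ψ₂, h₂⟩
    obtain ⟨E, _, _, _, ψ, hle₁, hle₂⟩ := exists_etale_le_range ψ₁ ψ₂
    exact ⟨E, inferInstance, inferInstance, inferInstance, ψ, add_mem (hle₁ h₁) (hle₂ h₂)⟩
  algebraMap_mem' r :=
    ⟨R, inferInstance, inferInstance, inferInstance, Algebra.ofId R S, ⟨r, rfl⟩⟩

/-- A simple root is the image of the variable under a map from the standard étale algebra
`E[X]/(F)` with `F'` inverted. -/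
lemma isEtaleElement_of_isRoot {E : Type u} [CommRing E] [Algebra R E] [Algebra.Etale R E]
    (ψ : E →ₐ[R] S) (F : E[X]) (hF : F.Monic) (a : S) (ha : F.eval₂ (ψ : E →+* S) a = 0)
    (hu : IsUnit (F.derivative.eval₂ (ψ : E →+* S) a)) : IsEtaleElement R a := by
  let P : StandardEtalePair E := ⟨F, hF, F.derivative, 1, 0, 1, by simp⟩
  let : Algebra E S := (ψ : E →+* S).toAlgebra
  let : Algebra R P.Ring := ((algebraMap E P.Ring).comp (algebraMap R E)).toAlgebra
  have : IsScalarTower R E P.Ring := .of_algebraMap_eq fun _ ↦ rfl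
  have : IsScalarTower R E S := .of_algebraMap_eq fun r ↦ (ψ.commutes r).symm
  have hmap : P.HasMap a := ⟨ha, hu⟩
  exact ⟨P.Ring, inferInstance, inferInstance, Algebra.Etale.comp R E P.Ring,
    (P.lift a hmap).restrictScalars R, P.X, by simp⟩

lemma isEtaleElement_of_mul_eq_one {a b : S} (ha : IsEtaleElement R a) (hab : a * b = 1) :
    IsEtaleElement R b := by
  obtain ⟨E, _, _, _, ψ, e, rfl⟩ := ha
  have hu : IsUnit ((ψ : E →+* S) e) := IsUnit.of_mul_eq_one _ hab
  have : IsUnit (ψ e) := hu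
  refine ⟨Localization.Away e, inferInstance, inferInstance,
    Algebra.Etale.comp R E _, IsLocalization.Away.liftAlgHom e (f := ψ) this,
    IsLocalization.Away.invSelf e, ?_⟩
  have h1 := congrArg (IsLocalization.Away.liftAlgHom (S := Localization.Away e) e (f := ψ) this)
    (IsLocalization.Away.mul_invSelf (S := Localization.Away e) e)
  rw [map_mul, map_one] at h1
  have h2 : IsLocalization.Away.liftAlgHom (S := Localization.Away e) e (f := ψ) this
    (algebraMap E (Localization.Away e) e) = ψ e := by simp
  rw [h2] at h1
  exact hu.mul_left_cancel (h1.trans hab.symm)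

lemma isLocalHom_val_etaleSubalgebra :
    IsLocalHom (etaleSubalgebra R S).val := by
  constructor
  rintro ⟨a, ha⟩ hu
  obtain ⟨b, hb⟩ := hu.exists_right_inv
  have hb' : a * b = 1 := hb
  exact IsUnit.of_mul_eq_one ⟨b, isEtaleElement_of_mul_eq_one ha hb'⟩ (Subtype.ext hb')

/-- The finitely many coefficients of a monic polynomial come from one étale algebra. Hensel's lemma
in `S` supplies a simple root, and a simple root over an étale algebra is again an étale element. -/
lemma henselianLocalRing_etaleSubalgebra [HenselianLocalRing S] :
    HenselianLocalRing (etaleSubalgebra R S) := by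
  have hloc : IsLocalHom ((etaleSubalgebra R S).val : etaleSubalgebra R S →+* S) :=
    ⟨isLocalHom_val_etaleSubalgebra.map_nonunit⟩
  have : IsLocalRing (etaleSubalgebra R S) :=
    RingHom.domain_isLocalRing ((etaleSubalgebra R S).val : etaleSubalgebra R S →+* S)
  refine ⟨fun f hf a₀ h0 h1 ↦ ?_⟩
  classical
  let ι : etaleSubalgebra R S →+* S := (etaleSubalgebra R S).val
  obtain ⟨E, _, _, _, ψ, hψ⟩ := exists_etale_forall_mem_range (R := R) (f.map ι).coeffs (by
    intro a ha
    obtain ⟨n, -, rfl⟩ := Polynomial.mem_coeffs_iff.mp ha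
    rw [Polynomial.coeff_map]
    exact (f.coeff n).2)
  have hlift : f.map ι ∈ Polynomial.lifts (ψ : E →+* S) := by
    rw [Polynomial.lifts_iff_coeff_lifts]
    intro n
    by_cases hn : (f.map ι).coeff n = 0
    · rw [hn]; exact ⟨0, map_zero _⟩
    · exact hψ _ (Polynomial.coeff_mem_coeffs hn)
  obtain ⟨F, hF, -, hFm⟩ := Polynomial.lifts_and_natDegree_eq_and_monic hlift (hf.map ι)
  have hmem : ∀ x : etaleSubalgebra R S, ι x ∈ maximalIdeal S ↔ x ∈ maximalIdeal _ := by
    intro x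
    rw [mem_maximalIdeal, mem_maximalIdeal, mem_nonunits_iff, mem_nonunits_iff, not_iff_not]
    exact ⟨fun h ↦ hloc.map_nonunit x h, fun h ↦ h.map ι⟩
  obtain ⟨a, ha, haa⟩ := HenselianLocalRing.is_henselian (f.map ι) (hf.map ι) (ι a₀)
    (by rw [Polynomial.eval_map_apply]; exact (hmem _).mpr h0)
    (by rw [Polynomial.derivative_map, Polynomial.eval_map_apply]; exact h1.map ι)
  have hev : ∀ p : E[X], p.eval₂ (ψ : E →+* S) a = (p.map (ψ : E →+* S)).eval a := fun p ↦
    (Polynomial.eval_map _ _).symm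
  have hda : IsUnit ((f.map ι).derivative.eval a) := by
    have hsub : (f.map ι).derivative.eval a - (f.map ι).derivative.eval (ι a₀) ∈ maximalIdeal S :=
      Ideal.mem_of_dvd _ (Polynomial.sub_dvd_eval_sub _ _ _) haa
    have hu : IsUnit ((f.map ι).derivative.eval (ι a₀)) := by
      rw [Polynomial.derivative_map, Polynomial.eval_map_apply]; exact h1.map ι
    by_contra hcon
    exact (mem_maximalIdeal _).mp ((Submodule.sub_mem_iff_right _
      ((mem_maximalIdeal _).mpr hcon)).mp hsub) hu
  have hae : IsEtaleElement R a := by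
    refine isEtaleElement_of_isRoot ψ F hFm a ?_ ?_
    · rw [hev, hF]; exact ha
    · rw [hev, ← Polynomial.derivative_map, hF]; exact hda
  refine ⟨⟨a, hae⟩, ?_, ?_⟩
  · have h2 : ι (f.eval ⟨a, hae⟩) = 0 := by
      rw [← Polynomial.eval_map_apply]; exact ha
    exact Subtype.ext h2
  · exact (hmem _).mp haa

end EtaleElements

/-- Every element of a Henselization is étale over the base. -/
lemma IsHenselization.isEtaleElement {R S : Type u} [CommRing R] [IsLocalRing R] [CommRing S]
    [Algebra R S] (h : IsHenselization R S) (a : S) : IsEtaleElement R a := by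
  have := h.henselianLocalRing
  have := h.isLocalHom
  have hH := henselianLocalRing_etaleSubalgebra (R := R) (S := S)
  let ι : etaleSubalgebra R S →+* S := (etaleSubalgebra R S).val
  have hι : IsLocalHom ι := ⟨isLocalHom_val_etaleSubalgebra.map_nonunit⟩
  have hloc : IsLocalHom (algebraMap R (etaleSubalgebra R S)) := by
    constructor
    intro r hr
    exact isUnit_of_map_unit (algebraMap R S) r (hr.map ι)
  obtain ⟨g, ⟨hg, hg'⟩, -⟩ := h.existsUnique_lift (etaleSubalgebra R S) _ hloc
  -- Both `ι ∘ g` and the identity lift `R → S`. They agree, so every element of `S` already lies in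
  -- the étale subalgebra.
  have huniq := (h.existsUnique_lift S (algebraMap R S) h.isLocalHom).unique
    (y₁ := ι.comp g) (y₂ := RingHom.id S)
    ⟨RingHom.isLocalHom_comp _ _, by rw [RingHom.comp_assoc, hg']; rfl⟩
    ⟨inferInstance, rfl⟩
  have := congrArg (fun f : S →+* S ↦ f a) huniq
  have h2 : ((g a : etaleSubalgebra R S) : S) = a := this
  rw [← h2]
  exact (g a).2

lemma henselianLocalRing_adicCompletion (R : Type u) [CommRing R] [IsLocalRing R]
    [IsNoetherianRing R] : HenselianLocalRing (AdicCompletion (maximalIdeal R) R) where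
  is_henselian f hf a₀ h₁ h₂ := HenselianRing.is_henselian (I := maximalIdeal _) f hf a₀ h₁
    (h₂.map _)

/-! ### Approximation in residually trivial algebras. -/

section ResiduallyTrivial

variable {R T : Type u} [CommRing R] [IsLocalRing R] [CommRing T] [Algebra R T]

lemma exists_sub_mem_map_pow_succ
    (hres : ∀ t : T, ∃ r : R, t - algebraMap R T r ∈ (maximalIdeal R).map (algebraMap R T))
    (k : ℕ) {c : T} (hc : c ∈ (maximalIdeal R ^ k).map (algebraMap R T)) :
    ∃ r ∈ maximalIdeal R ^ k,
      c - algebraMap R T r ∈ (maximalIdeal R ^ (k + 1)).map (algebraMap R T) := by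
  rw [← Submodule.restrictScalars_mem R, ← Ideal.smul_top_eq_map] at hc
  refine Submodule.smul_induction_on hc ?_ ?_
  · intro x hx t _
    obtain ⟨r, hr⟩ := hres t
    refine ⟨x * r, Ideal.mul_mem_right _ _ hx, ?_⟩
    rw [pow_succ, Ideal.map_mul, Algebra.smul_def, map_mul, ← mul_sub]
    exact Ideal.mul_mem_mul (Ideal.mem_map_of_mem _ hx) hr
  · rintro x y ⟨r, hr, hxr⟩ ⟨s, hs, hys⟩
    refine ⟨r + s, add_mem hr hs, ?_⟩
    rw [map_add, add_sub_add_comm]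
    exact add_mem hxr hys

lemma exists_sub_mem_map_pow
    (hres : ∀ t : T, ∃ r : R, t - algebraMap R T r ∈ (maximalIdeal R).map (algebraMap R T))
    (k : ℕ) (t : T) :
    ∃ r : R, t - algebraMap R T r ∈ (maximalIdeal R ^ k).map (algebraMap R T) := by
  induction k with
  | zero => exact ⟨0, by simp [Ideal.one_eq_top, Ideal.map_top]⟩
  | succ k ih =>
    obtain ⟨r, hr⟩ := ih
    obtain ⟨s, -, hs⟩ := exists_sub_mem_map_pow_succ hres k hr
    exact ⟨r + s, by rwa [map_add, ← sub_sub]⟩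

/-- Every ideal of a residually trivial algebra over a Noetherian local ring is contained in the
adic closure of a finitely generated subideal. -/
lemma exists_fg_le_forall_exists_sub_mem [IsNoetherianRing R]
    (hres : ∀ t : T, ∃ r : R, t - algebraMap R T r ∈ (maximalIdeal R).map (algebraMap R T))
    (I : Ideal T) :
    ∃ I₀ ≤ I, I₀.FG ∧
      ∀ (k : ℕ), ∀ a ∈ I, ∃ b ∈ I₀, a - b ∈ (maximalIdeal R ^ k).map (algebraMap R T) := by
  classical
  let m := maximalIdeal R
  let N : ℕ → Ideal T := fun k ↦ (m ^ k).map (algebraMap R T)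
  have hNmul (i k : ℕ) {c : R} {x : T} (hc : c ∈ m ^ i) (hx : x ∈ N k) :
      algebraMap R T c * x ∈ N (i + k) := by
    simp only [N, pow_add, Ideal.map_mul]
    exact Ideal.mul_mem_mul (Ideal.mem_map_of_mem _ hc) hx
  have hNanti : ∀ k, N (k + 1) ≤ N k := fun k ↦ Ideal.map_mono (Ideal.pow_le_pow_right k.le_succ)
  -- the filtration of `R` by initial forms of elements of `I`
  let J : m.Filtration R :=
    { N := fun k ↦
        { carrier := {r | r ∈ m ^ k ∧ ∃ a ∈ I, algebraMap R T r - a ∈ N (k + 1)}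
          add_mem' := by
            rintro r s ⟨hr, a, ha, hra⟩ ⟨hs, b, hb, hsb⟩
            refine ⟨add_mem hr hs, a + b, add_mem ha hb, ?_⟩
            rw [map_add, add_sub_add_comm]
            exact add_mem hra hsb
          zero_mem' := ⟨zero_mem _, 0, zero_mem _, by simp⟩
          smul_mem' := by
            rintro c r ⟨hr, a, ha, hra⟩
            refine ⟨Ideal.mul_mem_left _ _ hr, algebraMap R T c * a, Ideal.mul_mem_left _ _ ha, ?_⟩
            rw [smul_eq_mul, map_mul, ← mul_sub]
            exact Ideal.mul_mem_left _ _ hra }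
      mono := by
        rintro k r ⟨hr, -⟩
        exact ⟨Ideal.pow_le_pow_right k.le_succ hr, 0, zero_mem _, by
          rw [sub_zero]; exact Ideal.mem_map_of_mem _ hr⟩
      smul_le := by
        intro k
        rw [Submodule.smul_le]
        rintro c hc r ⟨hr, a, ha, hra⟩
        refine ⟨by rw [pow_succ']; exact Ideal.mul_mem_mul hc hr, algebraMap R T c * a,
          Ideal.mul_mem_left _ _ ha, ?_⟩
        rw [smul_eq_mul, map_mul, ← mul_sub, add_comm (k + 1) 1]
        exact hNmul 1 _ (by rwa [pow_one]) hra }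
  -- Artin–Rees in the Noetherian ring `R`: finitely many degrees determine all leading terms,
  -- although `T` is not known to be Noetherian.
  have hJ : J.Stable := (m.stableFiltration_stable (⊤ : Submodule R R)).of_le (by
    rintro k r ⟨hr, -⟩
    simpa using hr)
  obtain ⟨k₀, hk₀⟩ := hJ.exists_pow_smul_eq_of_ge
  have hlift (k : ℕ) : ∃ I₀ ≤ I, I₀.FG ∧ ∀ r ∈ J.N k, ∃ a ∈ I₀, algebraMap R T r - a ∈ N (k + 1) := by
    obtain ⟨s, hs⟩ := IsNoetherian.noetherian (J.N k)
    have hsJ : ∀ r ∈ s, ∃ a ∈ I, algebraMap R T r - a ∈ N (k + 1) := fun r hr ↦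
      (show r ∈ J.N k by rw [← hs]; exact Submodule.subset_span hr).2
    choose! a haI ha using hsJ
    refine ⟨Ideal.span (s.image a : Finset T), ?_, ⟨_, rfl⟩, ?_⟩
    · rw [Ideal.span_le]
      intro x hx
      obtain ⟨r, hr, rfl⟩ := Finset.mem_image.mp (Finset.mem_coe.mp hx)
      exact haI r hr
    · intro r hr
      rw [← hs] at hr
      induction hr using Submodule.span_induction with
      | mem r hr => exact ⟨a r, Ideal.subset_span (by simpa using ⟨r, hr, rfl⟩), ha r hr⟩
      | zero => exact ⟨0, zero_mem _, by simp⟩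
      | add x y _ _ hx hy =>
        obtain ⟨b, hb, hxb⟩ := hx
        obtain ⟨c, hc, hyc⟩ := hy
        exact ⟨b + c, add_mem hb hc, by rw [map_add, add_sub_add_comm]; exact add_mem hxb hyc⟩
      | smul c x _ hx =>
        obtain ⟨b, hb, hxb⟩ := hx
        exact ⟨algebraMap R T c * b, Ideal.mul_mem_left _ _ hb, by
          rw [smul_eq_mul, map_mul, ← mul_sub]; exact Ideal.mul_mem_left _ _ hxb⟩
  choose L hLI hLfg hL using hlift
  let I₀ : Ideal T := (Finset.range (k₀ + 1)).sup L
  have hLle : ∀ k ≤ k₀, L k ≤ I₀ := fun k hk ↦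
    Finset.le_sup (f := L) (Finset.mem_range.mpr (Nat.lt_succ_of_le hk))
  have hI₀ : I₀ ≤ I := Finset.sup_le fun k _ ↦ hLI k
  have key (k : ℕ) : ∀ r ∈ J.N k, ∃ a ∈ I₀, algebraMap R T r - a ∈ N (k + 1) := by
    obtain hk | hk := le_total k k₀
    · intro r hr
      obtain ⟨a, ha, h⟩ := hL k r hr
      exact ⟨a, hLle k hk ha, h⟩
    · intro r hr
      rw [hk₀ k hk] at hr
      refine Submodule.smul_induction_on hr ?_ ?_
      · intro c hc x hx
        obtain ⟨a, ha, h⟩ := hL k₀ x hx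
        refine ⟨algebraMap R T c * a, Ideal.mul_mem_left _ _ (hLle k₀ le_rfl ha), ?_⟩
        rw [smul_eq_mul, map_mul, ← mul_sub]
        have := hNmul _ _ hc h
        rwa [← add_assoc, Nat.sub_add_cancel hk] at this
      · rintro x y ⟨b, hb, hxb⟩ ⟨c, hc, hyc⟩
        exact ⟨b + c, add_mem hb hc, by rw [map_add, add_sub_add_comm]; exact add_mem hxb hyc⟩
  refine ⟨I₀, hI₀, Submodule.fg_finset_sup _ _ fun k _ ↦ hLfg k, fun k ↦ ?_⟩
  induction k with
  | zero => exact fun a _ ↦ ⟨0, zero_mem _, by simp [Ideal.one_eq_top, Ideal.map_top]⟩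
  | succ k ih =>
    intro a ha
    obtain ⟨b, hb, hab⟩ := ih a ha
    -- The error `a - b` lies in `I`, so its leading term `r` is in `J.N k` and can be matched by an
    -- element of `I₀`, improving the approximation by one order.
    obtain ⟨r, hr, h⟩ := exists_sub_mem_map_pow_succ hres k hab
    obtain ⟨b', hb', h'⟩ := key k r ⟨hr, a - b, sub_mem ha (hI₀ hb), by
      rw [← neg_sub]; exact neg_mem h⟩
    refine ⟨b + b', add_mem hb hb', ?_⟩
    have := add_mem h h'
    rwa [sub_add_sub_cancel, sub_sub] at this

end ResiduallyTrivial

/-! ### Flatness and Noetherianity of the Henselization. -/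

namespace IsHenselization

variable {R S : Type u} [CommRing R] [IsLocalRing R] [IsNoetherianRing R] [CommRing S]
  [Algebra R S]

lemma exists_lift_adicCompletion (h : IsHenselization R S) :
    ∃ j : S →+* AdicCompletion (maximalIdeal R) R, IsLocalHom j ∧
      j.comp (algebraMap R S) = algebraMap R (AdicCompletion (maximalIdeal R) R) := by
  have := henselianLocalRing_adicCompletion R
  exact (h.existsUnique_lift (AdicCompletion (maximalIdeal R) R) (algebraMap R _)
    inferInstance).exists

/-- The quotient map `R → R/𝔪^k` factors through `S`, by way of the completion. -/
lemma mem_pow_of_algebraMap_mem (h : IsHenselization R S) (k : ℕ) {r : R}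
    (hr : algebraMap R S r ∈ (maximalIdeal R ^ k).map (algebraMap R S)) :
    r ∈ maximalIdeal R ^ k := by
  obtain ⟨j, hj, hjR⟩ := h.exists_lift_adicCompletion
  let ε := (AdicCompletion.evalₐ (maximalIdeal R) k : _ →+* R ⧸ maximalIdeal R ^ k).comp j
  have hε : ε.comp (algebraMap R S) = Ideal.Quotient.mk (maximalIdeal R ^ k) := by
    rw [RingHom.comp_assoc, hjR]
    ext x
    simp
  have h1 := Ideal.mem_map_of_mem ε hr
  rw [Ideal.map_map, hε, Ideal.map_quotient_self, Ideal.mem_bot] at h1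
  have h2 : Ideal.Quotient.mk (maximalIdeal R ^ k) r = 0 := by rw [← hε]; exact h1
  exact Ideal.Quotient.eq_zero_iff_mem.mp h2

variable [IsLocalRing S]

lemma exists_sub_mem_maximalIdeal (h : IsHenselization R S) (a : S) :
    ∃ r : R, a - algebraMap R S r ∈ maximalIdeal S := by
  obtain ⟨j, hj, hjR⟩ := h.exists_lift_adicCompletion
  obtain ⟨x, hx⟩ := (AdicCompletion.residueField_map_bijective R).2 (residue _ (j a))
  obtain ⟨r, rfl⟩ := residue_surjective x
  refine ⟨r, ?_⟩
  rw [ResidueField.map_residue, ← sub_eq_zero, ← map_sub, residue_eq_zero_iff,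
    ← hjR, RingHom.comp_apply, ← map_sub, ← neg_mem_iff, ← map_neg, neg_sub] at hx
  rw [mem_maximalIdeal, mem_nonunits_iff] at hx ⊢
  exact fun hu ↦ hx (hu.map j)

/-- Finitely many elements of a Henselization lie in the image of a Noetherian local flat unramified
algebra. -/
lemma exists_local_forall_mem_range (h : IsHenselization R S) (s : Finset S) :
    ∃ (L : Type u) (_ : CommRing L) (_ : Algebra R L) (_ : IsLocalRing L) (_ : IsNoetherianRing L)
      (_ : Module.Flat R L) (Ψ : L →ₐ[R] S), IsLocalHom Ψ ∧
      (maximalIdeal R).map (algebraMap R L) = maximalIdeal L ∧ ∀ a ∈ s, a ∈ Ψ.range := by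
  obtain ⟨E, _, _, _, ψ, hψ⟩ := exists_etale_forall_mem_range s fun a _ ↦ h.isEtaleElement a
  let q : Ideal E := (maximalIdeal S).comap (ψ : E →+* S)
  have hq : q.IsPrime := Ideal.IsPrime.comap _
  have hu : ∀ y : q.primeCompl, IsUnit (ψ y) := fun y ↦ by
    by_contra hcon
    exact y.2 (show ψ y ∈ maximalIdeal S from (mem_maximalIdeal _).mpr hcon)
  let Ψ : Localization.AtPrime q →ₐ[R] S := IsLocalization.liftAlgHom (M := q.primeCompl) (f := ψ) hu
  have hΨ : ∀ e, Ψ (algebraMap E _ e) = ψ e := fun e ↦ by simp [Ψ]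
  have hloc : IsLocalHom Ψ := by
    constructor
    intro x hx
    obtain ⟨e, t, rfl⟩ := IsLocalization.exists_mk'_eq q.primeCompl x
    rw [IsLocalization.AtPrime.isUnit_mk'_iff (Localization.AtPrime q) q]
    intro he
    have h1 : IsUnit (ψ e) := by
      rw [← hΨ, ← IsLocalization.mk'_spec (Localization.AtPrime q) e t, map_mul]
      exact hx.mul (by rw [hΨ]; exact hu t)
    exact (mem_maximalIdeal _).mp (show ψ e ∈ maximalIdeal S from he) h1
  have hRloc : IsLocalHom (algebraMap R (Localization.AtPrime q)) := by
    constructor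
    intro r hr
    have := hr.map Ψ
    rw [AlgHom.commutes] at this
    exact h.isLocalHom.map_nonunit r this
  have hN : IsNoetherianRing E := Algebra.FiniteType.isNoetherianRing R E
  have hN' : IsNoetherianRing (Localization.AtPrime q) :=
    IsLocalization.isNoetherianRing q.primeCompl _ hN
  have hflat : Module.Flat R (Localization.AtPrime q) := Module.Flat.trans R E _
  have : Algebra.FormallyUnramified E (Localization.AtPrime q) :=
    Algebra.FormallyUnramified.of_isLocalization q.primeCompl
  have : Algebra.FormallyUnramified R (Localization.AtPrime q) :=
    Algebra.FormallyUnramified.comp R E _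
  have : Algebra.EssFiniteType E (Localization.AtPrime q) :=
    Algebra.EssFiniteType.of_isLocalization _ q.primeCompl
  have : Algebra.EssFiniteType R (Localization.AtPrime q) := Algebra.EssFiniteType.comp R E _
  refine ⟨Localization.AtPrime q, inferInstance, inferInstance, inferInstance, hN', hflat, Ψ, hloc,
    Algebra.FormallyUnramified.map_maximalIdeal, fun a ha ↦ ?_⟩
  obtain ⟨e, rfl⟩ := hψ a ha
  exact ⟨algebraMap E _ e, hΨ e⟩

lemma map_maximalIdeal (h : IsHenselization R S) :
    (maximalIdeal R).map (algebraMap R S) = maximalIdeal S := by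
  have := h.isLocalHom
  refine le_antisymm (((local_hom_TFAE (algebraMap R S)).out 0 2).mp h.isLocalHom) fun a ha ↦ ?_
  obtain ⟨L, _, _, _, _, _, Ψ, hΨ, hL, hs⟩ := h.exists_local_forall_mem_range {a}
  obtain ⟨x, rfl⟩ := hs a (Finset.mem_singleton_self a)
  have hx : x ∈ maximalIdeal L := by
    rw [mem_maximalIdeal, mem_nonunits_iff] at ha ⊢
    exact fun hu ↦ ha (hu.map Ψ)
  rw [← hL] at hx
  have := Ideal.mem_map_of_mem (Ψ : L →+* S) hx
  rw [Ideal.map_map] at this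
  rwa [Ψ.comp_algebraMap] at this

lemma exists_sub_mem_map (h : IsHenselization R S) (a : S) :
    ∃ r : R, a - algebraMap R S r ∈ (maximalIdeal R).map (algebraMap R S) := by
  rw [h.map_maximalIdeal]
  exact h.exists_sub_mem_maximalIdeal a

section

variable {L : Type u} [CommRing L] [Algebra R L] [IsLocalRing L]

lemma exists_sub_mem_map_of_algHom (h : IsHenselization R S) (Ψ : L →ₐ[R] S)
    (hL : (maximalIdeal R).map (algebraMap R L) = maximalIdeal L) (x : L) :
    ∃ r : R, x - algebraMap R L r ∈ (maximalIdeal R).map (algebraMap R L) := by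
  obtain ⟨r, hr⟩ := h.exists_sub_mem_maximalIdeal (Ψ x)
  refine ⟨r, ?_⟩
  rw [hL]
  rw [← Ψ.commutes, ← map_sub, mem_maximalIdeal, mem_nonunits_iff] at hr
  exact fun hu ↦ hr (hu.map Ψ)

/-- Modulo `𝔪^k`, coefficients in `S` can be replaced by elements of `R`, so approximations of `Ψ x`
by the extended ideal descend to approximations of `x` by `I`. Ideals of the Noetherian local ring
`L` are closed by Krull's intersection theorem. -/
lemma mem_of_forall_exists_sub_mem (h : IsHenselization R S) [IsNoetherianRing L] (Ψ : L →ₐ[R] S)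
    (hL : (maximalIdeal R).map (algebraMap R L) = maximalIdeal L)
    (I : Ideal L) (x : L)
    (hx : ∀ k, ∃ b ∈ I.map (Ψ : L →+* S),
      Ψ x - b ∈ (maximalIdeal R ^ k).map (algebraMap R S)) : x ∈ I := by
  have hmapΨ (k : ℕ) {y : L} (hy : y ∈ (maximalIdeal R ^ k).map (algebraMap R L)) :
      Ψ y ∈ (maximalIdeal R ^ k).map (algebraMap R S) := by
    have := Ideal.mem_map_of_mem (Ψ : L →+* S) hy
    rw [Ideal.map_map, Ψ.comp_algebraMap] at this
    exact this
  have happ (k : ℕ) : ∀ b ∈ I.map (Ψ : L →+* S), ∃ c ∈ I,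
      b - Ψ c ∈ (maximalIdeal R ^ k).map (algebraMap R S) := by
    intro b hb
    refine Submodule.span_induction ?_ ⟨0, zero_mem _, by simp⟩ ?_ ?_ hb
    · rintro _ ⟨c, hc, rfl⟩
      exact ⟨c, hc, by simp⟩
    · rintro y z _ _ ⟨c, hc, hyc⟩ ⟨d, hd, hzd⟩
      exact ⟨c + d, add_mem hc hd, by rw [map_add, add_sub_add_comm]; exact add_mem hyc hzd⟩
    · rintro t y _ ⟨c, hc, hyc⟩
      obtain ⟨r, hr⟩ := exists_sub_mem_map_pow h.exists_sub_mem_map k t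
      refine ⟨algebraMap R L r * c, Ideal.mul_mem_left _ _ hc, ?_⟩
      have : t • y - Ψ (algebraMap R L r * c) =
          t * (y - Ψ c) + (t - algebraMap R S r) * Ψ c := by
        rw [map_mul, Ψ.commutes, smul_eq_mul]; ring
      rw [this]
      exact add_mem (Ideal.mul_mem_left _ _ hyc) (Ideal.mul_mem_right _ _ hr)
  have hclose (k : ℕ) : ∃ c ∈ I, x - c ∈ (maximalIdeal R ^ k).map (algebraMap R L) := by
    obtain ⟨b, hb, hxb⟩ := hx k
    obtain ⟨c, hc, hbc⟩ := happ k b hb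
    refine ⟨c, hc, ?_⟩
    obtain ⟨r, hr⟩ := exists_sub_mem_map_pow (h.exists_sub_mem_map_of_algHom Ψ hL) k (x - c)
    have h1 := add_mem hxb hbc
    rw [sub_add_sub_cancel, ← map_sub] at h1
    have h2 := sub_mem h1 (hmapΨ k hr)
    rw [← map_sub, sub_sub_cancel, Ψ.commutes] at h2
    have h3 := h.mem_pow_of_algebraMap_mem k h2
    have := add_mem hr (Ideal.mem_map_of_mem (algebraMap R L) h3)
    rwa [sub_add_cancel] at this
  by_cases hI : I = ⊤
  · rw [hI]; trivial
  have hmk : Ideal.Quotient.mk I x ∈ (⨅ k : ℕ, maximalIdeal L ^ k • ⊤ : Submodule L (L ⧸ I)) := by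
    rw [Submodule.mem_iInf]
    intro k
    obtain ⟨c, hc, hxc⟩ := hclose k
    have : Ideal.Quotient.mk I x = (x - c) • (1 : L ⧸ I) := by
      rw [Algebra.smul_def, mul_one, Ideal.Quotient.algebraMap_eq, map_sub,
        Ideal.Quotient.eq_zero_iff_mem.mpr hc, sub_zero]
    rw [this]
    refine Submodule.smul_mem_smul ?_ trivial
    rwa [Ideal.map_pow, hL] at hxc
  rw [Ideal.iInf_pow_smul_eq_bot_of_isLocalRing _ (Ideal.IsPrime.ne_top'), Submodule.mem_bot] at hmk
  exact Ideal.Quotient.eq_zero_iff_mem.mp hmk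

lemma injective_of_map_maximalIdeal (h : IsHenselization R S) [IsNoetherianRing L] (Ψ : L →ₐ[R] S)
    (hL : (maximalIdeal R).map (algebraMap R L) = maximalIdeal L) :
    Function.Injective Ψ := by
  rw [injective_iff_map_eq_zero]
  intro x hx
  exact h.mem_of_forall_exists_sub_mem Ψ hL ⊥ x fun k ↦ ⟨0, zero_mem _, by simp [hx]⟩

end

/-- Equational criterion: a relation in `S` already holds in some flat local `L`, which injects into
`S`, and is trivial there. -/
lemma flat (h : IsHenselization R S) : Module.Flat R S := by
  classical
  rw [Module.Flat.iff_forall_isTrivialRelation]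
  intro l f x hfx
  obtain ⟨L, _, _, _, _, _, Ψ, hΨ, hL, hs⟩ :=
    h.exists_local_forall_mem_range (Finset.univ.image x)
  choose y hy using fun i ↦ hs (x i) (Finset.mem_image_of_mem _ (Finset.mem_univ i))
  have hy' : ∀ i, Ψ (y i) = x i := hy
  have hfy : ∑ i, f i • y i = 0 := by
    apply h.injective_of_map_maximalIdeal Ψ hL
    simpa [map_sum, hy'] using hfx
  obtain ⟨k, a, z, hz, ha⟩ :=
    (Module.Flat.iff_forall_isTrivialRelation (R := R) (M := L)).mp ‹_› hfy
  exact ⟨k, a, fun j ↦ Ψ (z j), fun i ↦ by rw [← hy', hz, map_sum]; simp, ha⟩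

/-- Each ideal lies in the adic closure of a finitely generated subideal. Any given element and the
generators live in one Noetherian `L`, where closedness of ideals gives membership. -/
lemma isNoetherianRing (h : IsHenselization R S) : IsNoetherianRing S := by
  classical
  rw [isNoetherianRing_iff_ideal_fg]
  intro I
  obtain ⟨I₀, hle, ⟨t, ht⟩, hI⟩ := exists_fg_le_forall_exists_sub_mem h.exists_sub_mem_map I
  suffices I ≤ I₀ by rw [le_antisymm this hle]; exact ⟨t, ht⟩
  intro a ha
  obtain ⟨L, _, _, _, _, _, Ψ, hΨ, hL, hs⟩ := h.exists_local_forall_mem_range (insert a t)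
  obtain ⟨x, hx⟩ := hs a (Finset.mem_insert_self a t)
  have hx' : Ψ x = a := hx
  have hmap : ((Ideal.span (t : Set S)).comap (Ψ : L →+* S)).map (Ψ : L →+* S) = I₀ := by
    refine le_antisymm ?_ ?_
    · rw [Ideal.map_le_iff_le_comap, ← ht]
    · rw [← ht, Ideal.span_le]
      intro b hb
      obtain ⟨y, hy⟩ := hs b (Finset.mem_insert_of_mem hb)
      have hy' : (Ψ : L →+* S) y = b := hy
      rw [← hy']
      refine Ideal.mem_map_of_mem _ ?_
      rw [Ideal.mem_comap, hy']
      exact Ideal.subset_span hb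
  have := h.mem_of_forall_exists_sub_mem Ψ hL _ x fun k ↦ by
    rw [hmap, hx']; exact hI k a ha
  rw [Ideal.mem_comap] at this
  rw [← ht, ← hx']
  exact this

lemma faithfullyFlat (h : IsHenselization R S) : Module.FaithfullyFlat R S := by
  have := h.flat
  have := h.isLocalHom
  exact Module.FaithfullyFlat.of_flat_of_isLocalHom

end IsHenselization

/-- `M` is a retract of `N`: the identity of `M` factors through `N`. -/
def IsRetract (A : Type*) [CommRing A] (M N : Type*) [AddCommGroup M] [Module A M]
    [AddCommGroup N] [Module A N] : Prop :=
  ∃ (i : M →ₗ[A] N) (p : N →ₗ[A] M), p ∘ₗ i = LinearMap.id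

/-! ### Retracts, and finite modules as retracts of extended modules. -/

section

variable {A : Type*} [CommRing A] {M N P : Type*} [AddCommGroup M] [Module A M]
    [AddCommGroup N] [Module A N] [AddCommGroup P] [Module A P]

lemma IsRetract.trans (h₁ : IsRetract A M N) (h₂ : IsRetract A N P) : IsRetract A M P := by
  obtain ⟨i, p, hip⟩ := h₁
  obtain ⟨j, q, hjq⟩ := h₂
  refine ⟨j ∘ₗ i, p ∘ₗ q, ?_⟩
  rw [LinearMap.comp_assoc, ← LinearMap.comp_assoc i j q, hjq, LinearMap.id_comp, hip]

lemma IsRetract.of_linearEquiv (e : M ≃ₗ[A] N) : IsRetract A M N :=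
  ⟨e, e.symm, by simp⟩

lemma IsRetract.finite (h : IsRetract A M N) [Module.Finite A N] : Module.Finite A M := by
  obtain ⟨i, p, hip⟩ := h
  exact Module.Finite.of_surjective p fun m ↦ ⟨i m, congrArg (fun f : M →ₗ[A] M ↦ f m) hip⟩

lemma IsRetract.nontrivial (h : IsRetract A M N) [Nontrivial M] : Nontrivial N := by
  obtain ⟨i, p, hip⟩ := h
  exact Function.Injective.nontrivial (f := i)
    (Function.LeftInverse.injective fun m ↦ congrArg (fun f : M →ₗ[A] M ↦ f m) hip)

end

/-- Finitely presented modules over an algebra all of whose elements are étale are retracts of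
extended modules. -/
lemma exists_isRetract_tensorProduct {R S : Type u} [CommRing R] [CommRing S] [Algebra R S]
    [IsNoetherianRing S] (hS : ∀ a : S, IsEtaleElement R a)
    (M : Type u) [AddCommGroup M] [Module S M] [Module.Finite S M] :
    ∃ (Y : Type u) (_ : AddCommGroup Y) (_ : Module R Y),
      Module.Finite R Y ∧ IsRetract S M (S ⊗[R] Y) := by
  classical
  obtain ⟨n, f, hf⟩ := Module.Finite.exists_fin' S M
  obtain ⟨rel, hrel⟩ := IsNoetherian.noetherian (LinearMap.ker f)
  obtain ⟨E, _, _, _, ψ, hψ⟩ := exists_etale_forall_mem_range (R := R)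
    (rel.biUnion fun ρ ↦ Finset.univ.image ρ) (fun a _ ↦ hS a)
  have hlift : ∀ ρ ∈ rel, ∃ ρ' : Fin n → E, (fun i ↦ ψ (ρ' i)) = ρ := fun ρ hρ ↦ by
    choose ρ' hρ' using fun i ↦ hψ (ρ i) (Finset.mem_biUnion.mpr
      ⟨ρ, hρ, Finset.mem_image_of_mem _ (Finset.mem_univ i)⟩)
    exact ⟨ρ', funext hρ'⟩
  choose! l hl using hlift
  let : Algebra E S := (ψ : E →+* S).toAlgebra
  let : Module E M := Module.compHom M (ψ : E →+* S)
  let : Module R M := Module.compHom M (algebraMap R S)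
  have : IsScalarTower R E S := .of_algebraMap_eq fun r ↦ (ψ.commutes r).symm
  have : IsScalarTower E S M := ⟨fun e s m ↦ mul_smul (ψ e) s m⟩
  have : IsScalarTower R S M := ⟨fun r s m ↦ by
    rw [Algebra.smul_def]; exact mul_smul (algebraMap R S r) s m⟩
  have : IsScalarTower R E M := ⟨fun r e m ↦ by
    change ψ (r • e) • m = algebraMap R S r • ψ e • m
    rw [map_smul, Algebra.smul_def, mul_smul]⟩
  have hEM (e : E) (m : M) : e • m = ψ e • m := rfl
  -- the module over `E` with the lifted relations
  let K : Submodule E (Fin n → E) := Submodule.span E (rel.image l : Finset _)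
  let N := (Fin n → E) ⧸ K
  let g : (Fin n → E) →ₗ[E] M := Fintype.linearCombination E (fun i ↦ f (Pi.single i 1))
  have hgf (v : Fin n → E) : g v = f (fun i ↦ ψ (v i)) := by
    rw [LinearMap.pi_apply_eq_sum_univ f, Fintype.linearCombination_apply]
    refine Finset.sum_congr rfl fun i _ ↦ ?_
    rw [hEM]
    congr 2
    ext j
    simp [Pi.single_apply, eq_comm]
  have hK : K ≤ LinearMap.ker g := by
    rw [Submodule.span_le]
    intro x hx
    obtain ⟨ρ, hρ, rfl⟩ := Finset.mem_image.mp (Finset.mem_coe.mp hx)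
    rw [SetLike.mem_coe, LinearMap.mem_ker, hgf, hl ρ hρ, ← LinearMap.mem_ker, ← hrel]
    exact Submodule.subset_span hρ
  let φ : N →ₗ[E] M := K.liftQ g hK
  let ν : Fin n → N := fun i ↦ K.mkQ (Pi.single i 1)
  have hφν (i : Fin n) : φ (ν i) = f (Pi.single i 1) := by
    change g (Pi.single i 1) = _
    rw [hgf]
    congr 1
    ext j
    simp [Pi.single_apply, apply_ite ψ]
  -- Unramifiedness splits the multiplication map `μ : E ⊗[R] N → N` over `E`.
  let σ := Algebra.FormallyUnramified.sec R E N
  let μ : E ⊗[R] N →ₗ[E] N := TensorProduct.AlgebraTensorModule.lift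
      ((Algebra.lsmul E E N).toLinearMap.flip.restrictScalars R).flip
  have hμσ (x : N) : μ (σ x) = x :=
    congrArg (fun F : N →ₗ[E] N ↦ F x) (Algebra.FormallyUnramified.comp_sec R E N)
  have hμ (e : E) (x : N) : μ (e ⊗ₜ x) = e • x := rfl
  -- `N` need not be finite over `R`; only the images of its generators matter. Flatness of `E`
  -- ensures that relations among them already hold over `N₀`.
  obtain ⟨N₀, hN₀, hσ⟩ := TensorProduct.exists_finite_submodule_right_of_setFinite
    (Set.range fun i ↦ σ (ν i)) (Set.finite_range _)
  choose τ hτ using fun i ↦ hσ ⟨i, rfl⟩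
  let incl : E ⊗[R] N₀ →ₗ[E] E ⊗[R] N := N₀.subtype.baseChange E
  have hincl : Function.Injective incl :=
    Module.Flat.lTensor_preserves_injective_linearMap (M := E) N₀.subtype N₀.injective_subtype
  have hτ' (i : Fin n) : incl (τ i) = σ (ν i) := hτ i
  have hrelτ : ∀ ρ ∈ rel, ∑ i, l ρ i • τ i = 0 := by
    intro ρ hρ
    apply hincl
    rw [map_sum, map_zero]
    simp_rw [map_smul, hτ']
    simp_rw [← map_smul, ← map_sum]
    have : ∑ i, l ρ i • ν i = 0 := by
      simp_rw [ν, ← map_smul, ← map_sum]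
      have h1 : ∑ i, l ρ i • (Pi.single i 1 : Fin n → E) = l ρ := by
        ext j
        simp [Finset.sum_apply, Pi.single_apply]
      rw [h1, Submodule.mkQ_apply, Submodule.Quotient.mk_eq_zero]
      exact Submodule.subset_span (by simpa using ⟨ρ, hρ, rfl⟩)
    rw [this, map_zero]
  let θ : E ⊗[R] N₀ →ₗ[E] S ⊗[R] N₀ :=
    TensorProduct.AlgebraTensorModule.map (Algebra.linearMap E S) LinearMap.id
  let π : S ⊗[R] N₀ →ₗ[S] M := (((φ.restrictScalars R) ∘ₗ N₀.subtype)).liftBaseChange S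
  have hπθ (x : E ⊗[R] N₀) : π (θ x) = φ (μ (incl x)) := by
    induction x with
    | zero => simp
    | add x y hx hy => simp only [map_add, hx, hy]
    | tmul e x =>
      change ψ e • φ x = φ (μ (e ⊗ₜ (x : N)))
      rw [hμ, map_smul]
      rfl
  let ι' : (Fin n → S) →ₗ[S] S ⊗[R] N₀ := Fintype.linearCombination S (fun i ↦ θ (τ i))
  have hι' : LinearMap.ker f ≤ LinearMap.ker ι' := by
    rw [← hrel, Submodule.span_le]
    intro ρ hρ
    rw [SetLike.mem_coe, LinearMap.mem_ker, Fintype.linearCombination_apply]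
    have h1 := congrArg θ (hrelτ ρ hρ)
    rw [map_sum, map_zero] at h1
    rw [← h1]
    refine Finset.sum_congr rfl fun i _ ↦ ?_
    rw [map_smul, ← congrFun (hl ρ hρ) i]
    exact algebraMap_smul S (l ρ i) (θ (τ i))
  let ι : M →ₗ[S] S ⊗[R] N₀ :=
    (LinearMap.ker f).liftQ ι' hι' ∘ₗ (f.quotKerEquivOfSurjective hf).symm.toLinearMap
  have hιf (v : Fin n → S) : ι (f v) = ι' v := by
    have : (f.quotKerEquivOfSurjective hf).symm (f v) = (LinearMap.ker f).mkQ v := by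
      rw [LinearEquiv.symm_apply_eq]; rfl
    change (LinearMap.ker f).liftQ ι' hι' ((f.quotKerEquivOfSurjective hf).symm (f v)) = _
    rw [this]
    rfl
  refine ⟨N₀, inferInstance, inferInstance, hN₀, ι, π, ?_⟩
  have : (π ∘ₗ ι) ∘ₗ f = f := by
    refine LinearMap.pi_ext' fun i ↦ LinearMap.ext_ring ?_
    change π (ι (f (Pi.single i 1))) = f (Pi.single i 1)
    rw [hιf]
    have : ι' (Pi.single i 1) = θ (τ i) := by
      simp [ι', Fintype.linearCombination_apply, Pi.single_apply, ite_smul]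
    rw [this, hπθ, hτ', hμσ, hφν]
  ext m
  obtain ⟨v, rfl⟩ := hf m
  exact congrArg (fun F : (Fin n → S) →ₗ[S] M ↦ F v) this

/-! ### Finite algebras and indecomposable modules over a Henselian local ring. -/

section HenselianLocal

variable {S : Type u} [CommRing S] [HenselianLocalRing S]

/-- An étale algebra over a Henselian local ring has a section at each residually trivial point over
the closed point. -/
lemma exists_algHom_comap_eq (E : Type u) [CommRing E] [Algebra S E] [Algebra.Etale S E]
    (P : Ideal E) [P.IsPrime] [P.LiesOver (maximalIdeal S)]
    (hP : Function.Surjective (algebraMap S P.ResidueField)) :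
    ∃ σ : E →ₐ[S] S, (maximalIdeal S).comap (σ : E →+* S) = P := by
  obtain ⟨f, hfP, hf⟩ := Algebra.IsEtaleAt.exists_isStandardEtale (R := S) P
  have pres : StandardEtalePresentation S (Localization.Away f) :=
    hf.nonempty_standardEtalePresentation.some
  have hfu : IsUnit (IsScalarTower.toAlgHom S E P.ResidueField f) := by
    rw [isUnit_iff_ne_zero]
    exact fun h ↦ hfP (Ideal.algebraMap_residueField_eq_zero.mp h)
  let κ : Localization.Away f →ₐ[S] P.ResidueField :=
    IsLocalization.Away.liftAlgHom f (f := IsScalarTower.toAlgHom S E P.ResidueField) hfu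
  have hκ (e : E) : κ (algebraMap E _ e) = algebraMap E P.ResidueField e := by simp [κ]
  have hker (a : S) : algebraMap S P.ResidueField a = 0 ↔ a ∈ maximalIdeal S := by
    rw [IsScalarTower.algebraMap_apply S E P.ResidueField, Ideal.algebraMap_residueField_eq_zero,
      (‹P.LiesOver (maximalIdeal S)›).over]
    rfl
  have hunit (a : S) : IsUnit (algebraMap S P.ResidueField a) ↔ IsUnit a := by
    rw [isUnit_iff_ne_zero, ne_eq, hker, mem_maximalIdeal, mem_nonunits_iff, not_not]
  -- Near `P` the algebra is standard étale, and the residue point is a simple root of its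
  -- polynomial modulo the maximal ideal; lifting this root defines the section.
  obtain ⟨a₀, ha₀⟩ := hP (κ pres.x)
  have hev (p : S[X]) : algebraMap S P.ResidueField (p.eval a₀) = κ (aeval pres.x p) := by
    rw [← aeval_algHom_apply, ← ha₀, aeval_algebraMap_apply, coe_aeval_eq_eval]
  obtain ⟨a, ha, haa⟩ := HenselianLocalRing.is_henselian pres.f pres.monic_f a₀
    (by rw [← hker, hev, pres.hasMap.1, map_zero])
    (by rw [← hunit, hev]; exact pres.hasMap.isUnit_derivative_f.map κ)
  have haκ : algebraMap S P.ResidueField a = κ pres.x := by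
    rw [← ha₀, ← sub_eq_zero, ← map_sub, hker]; exact haa
  have hmap : pres.HasMap a := by
    refine ⟨by rw [coe_aeval_eq_eval]; exact ha, ?_⟩
    rw [← hunit, ← aeval_algebraMap_apply, haκ, aeval_algHom_apply]
    exact pres.hasMap.2.map κ
  let ρ : Localization.Away f →ₐ[S] S := (pres.lift a hmap).comp pres.equivRing.toAlgHom
  have hρ : (Algebra.ofId S P.ResidueField).comp ρ = κ := by
    apply pres.hom_ext
    simpa [ρ, Algebra.ofId_apply] using haκ
  refine ⟨ρ.comp (IsScalarTower.toAlgHom S E _), ?_⟩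
  ext e
  change ρ (algebraMap E _ e) ∈ maximalIdeal S ↔ _
  rw [← hker, ← Ideal.algebraMap_residueField_eq_zero (I := P), ← hκ, ← hρ]
  rfl

/-- A finite algebra without nontrivial idempotents over a Henselian local ring is local. -/
lemma isLocalRing_of_forall_isIdempotentElem (A : Type u) [CommRing A] [Nontrivial A] [Algebra S A]
    [Module.Finite S A] (hA : ∀ e : A, IsIdempotentElem e → e = 0 ∨ e = 1) : IsLocalRing A := by
  obtain ⟨E, _, _, _, P, _, _, n, e, he, P', _, _, hP, -, H⟩ :=
    Algebra.exists_etale_completeOrthogonalIdempotents_forall_liesOver_eq (S := A) (maximalIdeal S)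
  have hsurj : Function.Surjective (algebraMap S P.ResidueField) := by
    intro x
    obtain ⟨y, rfl⟩ := hP.2 x
    obtain ⟨s, rfl⟩ := Ideal.algebraMap_residueField_surjective (maximalIdeal S) y
    exact ⟨s, by
      rw [AlgHom.commutes]⟩
  obtain ⟨σ, hσ⟩ := exists_algHom_comap_eq E P hsurj
  let τ : E ⊗[S] A →ₐ[S] A :=
    Algebra.TensorProduct.productMap ((Algebra.ofId S A).comp σ) (AlgHom.id S A)
  have hτ : Function.Surjective τ := fun a ↦ ⟨1 ⊗ₜ a, by simp [τ]⟩
  have hprime (Q : Ideal A) [Q.IsMaximal] :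
      ∃ h : (Q.comap (τ : E ⊗[S] A →+* A)).IsPrime, (Q.comap (τ : E ⊗[S] A →+* A)).LiesOver P := by
    refine ⟨Ideal.IsPrime.comap _, ⟨?_⟩⟩
    have hQ : Q.comap (algebraMap S A) = maximalIdeal S :=
      eq_maximalIdeal (Ideal.isMaximal_comap_of_isIntegral_of_isMaximal Q)
    rw [← hσ, ← hQ]
    ext x
    change algebraMap S A (σ x) ∈ Q ↔ τ (x ⊗ₜ 1) ∈ Q
    simp [τ, Algebra.ofId_apply]
  -- The section pulls the étale-local idempotent decomposition back to `A`, where only trivial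
  -- idempotents exist. Some `e i` other than the last maps to `1`, and this forces every maximal
  -- ideal of `A` to pull back to `P' i`.
  have hidem (i) : τ (e i) = 0 ∨ τ (e i) = 1 := hA _ ((he.idem i).map τ)
  obtain ⟨Q₀, hQ₀⟩ := Ideal.exists_maximal A
  have hlast : τ (e (Fin.last n)) = 0 := by
    refine (hidem _).resolve_right fun h1 ↦ ?_
    obtain ⟨_, _⟩ := hprime Q₀
    have h2 : τ (e (Fin.last n)) ∈ Q₀ :=
      (H (Q₀.comap (τ : E ⊗[S] A →+* A)) inferInstance inferInstance).1
    rw [h1] at h2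
    exact hQ₀.ne_top (Q₀.eq_top_of_isUnit_mem h2 isUnit_one)
  have hex : ∃ i : Fin n, τ (e i.castSucc) = 1 := by
    by_contra! hcon
    have hsum := congrArg τ he.complete
    rw [map_sum, map_one, Fin.sum_univ_castSucc, hlast, add_zero,
      Finset.sum_eq_zero fun i _ ↦ (hidem _).resolve_right (hcon i)] at hsum
    exact zero_ne_one hsum
  obtain ⟨i, hi⟩ := hex
  have hQ (Q : Ideal A) (hQm : Q.IsMaximal) : Q.comap (τ : E ⊗[S] A →+* A) = P' i := by
    obtain ⟨_, _⟩ := hprime Q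
    refine (H (Q.comap (τ : E ⊗[S] A →+* A)) inferInstance inferInstance).2 i fun h2 ↦ ?_
    have h3 : τ (e i.castSucc) ∈ Q := h2
    rw [hi] at h3
    exact hQm.ne_top (Q.eq_top_of_isUnit_mem h3 isUnit_one)
  refine IsLocalRing.of_unique_max_ideal ⟨Q₀, hQ₀, fun Q hQm ↦ ?_⟩
  exact Ideal.comap_injective_of_surjective (τ : E ⊗[S] A →+* A) hτ
    ((hQ Q hQm).trans (hQ Q₀ hQ₀).symm)

variable {M : Type u} [AddCommGroup M] [Module S M] [Module.Finite S M]

/-- The endomorphism ring of an indecomposable finite module over a Henselian local ring is local. -/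
lemma IsIndecomposable.isUnit_or_isUnit_one_sub [IsNoetherianRing S] (hM : IsIndecomposable S M)
    (f : Module.End S M) : IsUnit f ∨ IsUnit (1 - f) := by
  have := hM.1
  -- The commutative subalgebra `S[f]` of the endomorphism ring is finite over `S`, and its
  -- idempotents are trivial because they split `M`; hence it is local.
  let I := RingHom.ker (aeval (R := S) f)
  let φ : S[X] ⧸ I →ₐ[S] Module.End S M := Ideal.kerLiftAlg (aeval (R := S) f)
  have hφ : Function.Injective φ := Ideal.kerLiftAlg_injective _
  have : Nontrivial (S[X] ⧸ I) := φ.toRingHom.domain_nontrivial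
  have : IsNoetherian S (Module.End S M) := isNoetherian_of_isNoetherianRing_of_finite S _
  have : Module.Finite S (S[X] ⧸ I) := Module.Finite.of_injective φ.toLinearMap hφ
  have hidem (e : S[X] ⧸ I) (he : IsIdempotentElem e) : e = 0 ∨ e = 1 := by
    have he' : IsIdempotentElem (φ e) := he.map φ
    rcases hM.2 _ _ (LinearMap.IsIdempotentElem.isCompl he') with h | h
    · left
      apply hφ
      rw [map_zero]
      exact LinearMap.range_eq_bot.mp h
    · right
      apply hφ
      rw [map_one]
      ext m
      have h1 : φ e m - m ∈ LinearMap.ker (φ e) := by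
        rw [LinearMap.mem_ker, map_sub, sub_eq_zero]
        exact congrArg (fun F : Module.End S M ↦ F m) he'
      rw [h, Submodule.mem_bot, sub_eq_zero] at h1
      exact h1
  have := isLocalRing_of_forall_isIdempotentElem (S := S) (S[X] ⧸ I) hidem
  have hX : φ (Ideal.Quotient.mk I X) = f := by
    change aeval f X = f
    simp
  rcases IsLocalRing.isUnit_or_isUnit_of_add_one
    (add_sub_cancel (Ideal.Quotient.mk I X) 1) with h | h
  · left
    rw [← hX]
    exact h.map φ
  · right
    rw [← hX, ← map_one φ, ← map_sub]
    exact h.map φ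

/-- The identity is a sum of an endomorphism through `N₁` and one through `N₂`; by the local
endomorphism property one of them is invertible. -/
lemma IsIndecomposable.isRetract_or_isRetract [IsNoetherianRing S] (hM : IsIndecomposable S M)
    {N₁ N₂ : Type*} [AddCommGroup N₁] [Module S N₁] [AddCommGroup N₂] [Module S N₂]
    (h : IsRetract S M (N₁ × N₂)) : IsRetract S M N₁ ∨ IsRetract S M N₂ := by
  obtain ⟨i, p, hip⟩ := h
  let f : Module.End S M := p ∘ₗ LinearMap.inl S N₁ N₂ ∘ₗ LinearMap.fst S N₁ N₂ ∘ₗ i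
  let g : Module.End S M := p ∘ₗ LinearMap.inr S N₁ N₂ ∘ₗ LinearMap.snd S N₁ N₂ ∘ₗ i
  have hfg : 1 - f = g := by
    rw [sub_eq_iff_eq_add']
    refine Eq.trans hip.symm ?_
    ext m
    simp only [f, g, LinearMap.comp_apply, LinearMap.add_apply, ← map_add]
    simp
  rcases hM.isUnit_or_isUnit_one_sub f with hu | hu
  · left
    obtain ⟨u, hu⟩ := hu
    refine ⟨LinearMap.fst S N₁ N₂ ∘ₗ i, (↑u⁻¹ : Module.End S M) ∘ₗ p ∘ₗ LinearMap.inl S N₁ N₂, ?_⟩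
    change (↑u⁻¹ : Module.End S M) * f = 1
    rw [← hu, Units.inv_mul]
  · right
    rw [hfg] at hu
    obtain ⟨u, hu⟩ := hu
    refine ⟨LinearMap.snd S N₁ N₂ ∘ₗ i, (↑u⁻¹ : Module.End S M) ∘ₗ p ∘ₗ LinearMap.inr S N₁ N₂, ?_⟩
    change (↑u⁻¹ : Module.End S M) * g = 1
    rw [← hu, Units.inv_mul]

end HenselianLocal

/-! ### Vanishing of Ext and long exact sequences. -/

open CategoryTheory CategoryTheory.Abelian

/-- The vanishing of `Ext^i(M, N)`. -/
def ExtZero (A : Type u) [CommRing A] (M N : Type u) [AddCommGroup M] [Module A M]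
    [AddCommGroup N] [Module A N] (i : ℕ) : Prop :=
  Subsingleton (Ext.{u} (ModuleCat.of A M) (ModuleCat.of A N) i)

section

variable {A : Type u} [CommRing A] {M₁ M₂ M₃ : Type u} [AddCommGroup M₁] [Module A M₁]
  [AddCommGroup M₂] [Module A M₂] [AddCommGroup M₃] [Module A M₃]

lemma shortExact_moduleCatMk {f : M₁ →ₗ[A] M₂} {g : M₂ →ₗ[A] M₃} (hf : Function.Injective f)
    (hg : Function.Surjective g) (hfg : Function.Exact f g) :
    (ShortComplex.moduleCatMk f g hfg.linearMap_comp_eq_zero).ShortExact where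
  exact := (ShortComplex.ShortExact.moduleCat_exact_iff_function_exact _).mpr hfg
  mono_f := (ModuleCat.mono_iff_injective _).mpr hf
  epi_g := (ModuleCat.epi_iff_surjective _).mpr hg

section LongExact

variable {f : M₁ →ₗ[A] M₂} {g : M₂ →ₗ[A] M₃} (hf : Function.Injective f)
    (hg : Function.Surjective g) (hfg : Function.Exact f g)
    {X : Type u} [AddCommGroup X] [Module A X] {i : ℕ}
include hf hg hfg

lemma ExtZero.right_of_covariant (h₂ : ExtZero A X M₂ i) (h₁ : ExtZero A X M₁ (i + 1)) :
    ExtZero A X M₃ i := by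
  unfold ExtZero at *
  refine subsingleton_of_forall_eq 0 fun x ↦ ?_
  obtain ⟨y, hy⟩ := Ext.covariant_sequence_exact₃ (ModuleCat.of A X)
    (shortExact_moduleCatMk hf hg hfg) x rfl (Subsingleton.elim (h := h₁) _ _)
  obtain rfl : y = 0 := Subsingleton.elim (h := h₂) _ _
  exact hy.symm.trans (Ext.zero_comp ..)

lemma ExtZero.left_of_covariant (h₃ : ExtZero A X M₃ i) (h₂ : ExtZero A X M₂ (i + 1)) :
    ExtZero A X M₁ (i + 1) := by
  unfold ExtZero at *
  refine subsingleton_of_forall_eq 0 fun x ↦ ?_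
  obtain ⟨y, hy⟩ := Ext.covariant_sequence_exact₁ (ModuleCat.of A X)
    (shortExact_moduleCatMk hf hg hfg) x (Subsingleton.elim (h := h₂) _ _) rfl
  obtain rfl : y = 0 := Subsingleton.elim (h := h₃) _ _
  exact hy.symm.trans (Ext.zero_comp ..)

lemma ExtZero.middle_of_covariant (h₁ : ExtZero A X M₁ i) (h₃ : ExtZero A X M₃ i) :
    ExtZero A X M₂ i := by
  unfold ExtZero at *
  refine subsingleton_of_forall_eq 0 fun x ↦ ?_
  obtain ⟨y, hy⟩ := Ext.covariant_sequence_exact₂ (ModuleCat.of A X)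
    (shortExact_moduleCatMk hf hg hfg) x (Subsingleton.elim (h := h₃) _ _)
  obtain rfl : y = 0 := Subsingleton.elim (h := h₁) _ _
  exact hy.symm.trans (Ext.zero_comp ..)

lemma ExtZero.left_of_contravariant (h₂ : ExtZero A M₂ X i) (h₃ : ExtZero A M₃ X (i + 1)) :
    ExtZero A M₁ X i := by
  unfold ExtZero at *
  refine subsingleton_of_forall_eq 0 fun x ↦ ?_
  obtain ⟨y, hy⟩ := Ext.contravariant_sequence_exact₁
    (shortExact_moduleCatMk hf hg hfg) (ModuleCat.of A X) x (add_comm 1 i)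
    (Subsingleton.elim (h := h₃) _ _)
  obtain rfl : y = 0 := Subsingleton.elim (h := h₂) _ _
  exact hy.symm.trans (Ext.comp_zero ..)

lemma ExtZero.right_of_contravariant (h₁ : ExtZero A M₁ X i) (h₂ : ExtZero A M₂ X (i + 1)) :
    ExtZero A M₃ X (i + 1) := by
  unfold ExtZero at *
  refine subsingleton_of_forall_eq 0 fun x ↦ ?_
  obtain ⟨y, hy⟩ := Ext.contravariant_sequence_exact₃
    (shortExact_moduleCatMk hf hg hfg) (ModuleCat.of A X) x (Subsingleton.elim (h := h₂) _ _)
    (add_comm 1 i)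
  obtain rfl : y = 0 := Subsingleton.elim (h := h₁) _ _
  exact hy.symm.trans (Ext.comp_zero ..)

lemma ExtZero.middle_of_contravariant (h₁ : ExtZero A M₁ X i) (h₃ : ExtZero A M₃ X i) :
    ExtZero A M₂ X i := by
  unfold ExtZero at *
  refine subsingleton_of_forall_eq 0 fun x ↦ ?_
  obtain ⟨y, hy⟩ := Ext.contravariant_sequence_exact₂
    (shortExact_moduleCatMk hf hg hfg) (ModuleCat.of A X) x (Subsingleton.elim (h := h₁) _ _)
  obtain rfl : y = 0 := Subsingleton.elim (h := h₃) _ _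
  exact hy.symm.trans (Ext.comp_zero ..)

lemma ExtZero.exists_extend (h₃ : ExtZero A M₃ X 1) (φ : M₁ →ₗ[A] X) :
    ∃ ψ : M₂ →ₗ[A] X, ψ ∘ₗ f = φ := by
  unfold ExtZero at *
  obtain ⟨y, hy⟩ := Ext.contravariant_sequence_exact₁
    (shortExact_moduleCatMk hf hg hfg) (ModuleCat.of A X) (Ext.mk₀ (ModuleCat.ofHom φ))
    (add_zero 1) (Subsingleton.elim (h := h₃) _ _)
  obtain ⟨ψ, rfl⟩ := (Ext.mk₀_bijective _ _).2 y
  rw [Ext.mk₀_comp_mk₀] at hy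
  exact ⟨ψ.hom, congrArg ModuleCat.Hom.hom ((Ext.mk₀_bijective _ _).1 hy)⟩

/-- The connecting map onto `Ext^1(M₃, X)` is surjective by `h₂`, and it kills every map that
extends to `M₂`. -/
lemma ExtZero.right_one_of_forall_exists_extend
    (h : ∀ φ : M₁ →ₗ[A] X, ∃ ψ : M₂ →ₗ[A] X, ψ ∘ₗ f = φ) (h₂ : ExtZero A M₂ X 1) :
    ExtZero A M₃ X 1 := by
  unfold ExtZero at *
  refine subsingleton_of_forall_eq 0 fun x ↦ ?_
  have hS := shortExact_moduleCatMk hf hg hfg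
  obtain ⟨y, hy⟩ := Ext.contravariant_sequence_exact₃ hS (ModuleCat.of A X) x
    (Subsingleton.elim (h := h₂) _ _) (add_zero 1)
  obtain ⟨φ, rfl⟩ := (Ext.mk₀_bijective _ _).2 y
  obtain ⟨ψ, hψ⟩ := h φ.hom
  obtain ⟨ψ', rfl⟩ : ∃ ψ' : (ShortComplex.moduleCatMk f g hfg.linearMap_comp_eq_zero).X₂ ⟶
      ModuleCat.of A X, φ = (ShortComplex.moduleCatMk f g hfg.linearMap_comp_eq_zero).f ≫ ψ' :=
    ⟨ModuleCat.ofHom ψ, ModuleCat.hom_ext hψ.symm⟩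
  rw [← hy, ← Ext.mk₀_comp_mk₀, hS.extClass_comp_assoc]
  rfl

end LongExact

variable {M N X : Type u} [AddCommGroup M] [Module A M] [AddCommGroup N] [Module A N]
  [AddCommGroup X] [Module A X]

lemma extZero_succ_of_projective [Module.Projective A M] (i : ℕ) : ExtZero A M N (i + 1) := by
  have : Projective (ModuleCat.of A M) := (IsProjective.iff_projective M).mp inferInstance
  exact Ext.subsingleton_of_projective _ _ i

lemma ExtZero.covariant_of_isRetract (h : IsRetract A M N) {i : ℕ} (hN : ExtZero A X N i) :
    ExtZero A X M i := by
  unfold ExtZero at *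
  obtain ⟨j, p, hjp⟩ := h
  refine subsingleton_of_forall_eq 0 fun x ↦ ?_
  have h1 : ModuleCat.ofHom j ≫ ModuleCat.ofHom p = 𝟙 (ModuleCat.of A M) := ModuleCat.hom_ext hjp
  have h2 : x = (x.comp (Ext.mk₀ (ModuleCat.ofHom j)) (add_zero i)).comp
      (Ext.mk₀ (ModuleCat.ofHom p)) (add_zero i) := by
    rw [Ext.comp_assoc_of_third_deg_zero, Ext.mk₀_comp_mk₀, h1, Ext.comp_mk₀_id]
  rw [h2, Subsingleton.elim (h := hN) (x.comp _ _) 0, Ext.zero_comp]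

lemma ExtZero.contravariant_of_isRetract (h : IsRetract A M N) {i : ℕ} (hN : ExtZero A N X i) :
    ExtZero A M X i := by
  unfold ExtZero at *
  obtain ⟨j, p, hjp⟩ := h
  refine subsingleton_of_forall_eq 0 fun x ↦ ?_
  have h1 : ModuleCat.ofHom j ≫ ModuleCat.ofHom p = 𝟙 (ModuleCat.of A M) := ModuleCat.hom_ext hjp
  have h2 : x = (Ext.mk₀ (ModuleCat.ofHom j)).comp
      ((Ext.mk₀ (ModuleCat.ofHom p)).comp x (zero_add i)) (zero_add i) := by
    rw [Ext.mk₀_comp_mk₀_assoc, h1, Ext.mk₀_id_comp]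
  rw [h2, Subsingleton.elim (h := hN) (Ext.comp _ x _) 0, Ext.comp_zero]

lemma extZero_zero_iff : ExtZero A X M 0 ↔ Subsingleton (X →ₗ[A] M) :=
  ((Ext.addEquiv₀ (X := ModuleCat.of A X) (Y := ModuleCat.of A M)).trans
    ModuleCat.homAddEquiv).subsingleton_congr

lemma extZero_of_injectiveDimensionLE {n : ℕ}
    [HasInjectiveDimensionLE (ModuleCat.of A N) n] {i : ℕ} (hi : n < i) : ExtZero A M N i :=
  HasInjectiveDimensionLT.subsingleton (ModuleCat.of A N) (n + 1) i hi _

/-- If multiplication by an element of the maximal ideal is surjective on `Ext`, then `Ext`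
vanishes. -/
lemma extZero_of_isSMulRegular [IsLocalRing A] [IsNoetherianRing A] [Module.Finite A M]
    [Module.Finite A N] {x : A} (hx : x ∈ maximalIdeal A) (hreg : IsSMulRegular M x) {i : ℕ}
    (h : ExtZero A (QuotSMulTop x M) N (i + 1)) : ExtZero A M N i := by
  unfold ExtZero at *
  have hS := IsSMulRegular.smulShortComplex_shortExact (M := ModuleCat.of A M) hreg
  have hsurj : ∀ y : Ext.{u} (ModuleCat.of A M) (ModuleCat.of A N) i, ∃ z, x • z = y := by
    intro y
    obtain ⟨z, hz⟩ := Ext.contravariant_sequence_exact₁ hS (ModuleCat.of A N) y (add_comm 1 i)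
      (Subsingleton.elim (h := h) _ _)
    refine ⟨z, ?_⟩
    have key (w : Ext.{u} (ModuleCat.of A M) (ModuleCat.of A N) i) :
        (Ext.mk₀ (x • 𝟙 (ModuleCat.of A M))).comp w (zero_add i) = x • w := by
      rw [Ext.mk₀_smul, Ext.smul_comp, Ext.mk₀_id_comp]
    rw [← hz]
    exact (key z).symm
  by_contra hcon
  have : Nontrivial (Ext.{u} (ModuleCat.of A M) (ModuleCat.of A N) i) :=
    not_subsingleton_iff_nontrivial.mp hcon
  refine Submodule.top_ne_pointwise_smul_of_mem_jacobson_annihilator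
    (R := A) (M := Ext.{u} (ModuleCat.of A M) (ModuleCat.of A N) i)
    (IsLocalRing.maximalIdeal_le_jacobson _ hx) ?_
  rw [eq_comm, eq_top_iff]
  rintro y -
  obtain ⟨z, rfl⟩ := hsurj y
  exact Submodule.smul_mem_pointwise_smul _ _ ⊤ trivial

end

/-! ### Depth through Ext, and maximal Cohen–Macaulay modules. -/

section Depth

variable (A : Type u) [CommRing A] [IsLocalRing A]

/-- The homological form of `depth M ≥ n`: `Ext^i(k, M) = 0` for `i < n`. -/
def DepthGE (M : Type u) [AddCommGroup M] [Module A M] (n : ℕ) : Prop :=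
  ∀ i < n, ExtZero A (ResidueField A) M i

variable {A} {M N M₁ M₂ M₃ : Type u} [AddCommGroup M] [Module A M] [AddCommGroup N] [Module A N]
  [AddCommGroup M₁] [Module A M₁] [AddCommGroup M₂] [Module A M₂] [AddCommGroup M₃] [Module A M₃]

lemma DepthGE.of_isRetract {n : ℕ} (hN : DepthGE A N n) (h : IsRetract A M N) : DepthGE A M n :=
  fun i hi ↦ (hN i hi).covariant_of_isRetract h

lemma DepthGE.mono {n m : ℕ} (h : DepthGE A M n) (hm : m ≤ n) : DepthGE A M m :=
  fun i hi ↦ h i (hi.trans_le hm)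

section

variable {f : M₁ →ₗ[A] M₂} {g : M₂ →ₗ[A] M₃} (hf : Function.Injective f)
    (hg : Function.Surjective g) (hfg : Function.Exact f g) {n : ℕ}
include hf hg hfg

lemma DepthGE.right (h₂ : DepthGE A M₂ n) (h₁ : DepthGE A M₁ (n + 1)) : DepthGE A M₃ n :=
  fun i hi ↦ (h₂ i hi).right_of_covariant hf hg hfg (h₁ (i + 1) (by omega))

lemma DepthGE.left (h₃ : DepthGE A M₃ n) (h₂ : DepthGE A M₂ (n + 1)) :
    DepthGE A M₁ (n + 1) := by
  intro i hi
  cases i with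
  | zero =>
    have := extZero_zero_iff.mp (h₂ 0 hi)
    exact extZero_zero_iff.mpr ⟨fun a b ↦ (LinearMap.cancel_left hf).mp (Subsingleton.elim _ _)⟩
  | succ i => exact (h₃ i (by omega)).left_of_covariant hf hg hfg (h₂ (i + 1) hi)

end

lemma DepthGE.prod {n : ℕ} (hM : DepthGE A M n) (hN : DepthGE A N n) : DepthGE A (M × N) n :=
  fun i hi ↦ (hM i hi).middle_of_covariant (f := LinearMap.inl A M N) LinearMap.inl_injective
    LinearMap.snd_surjective .inl_snd (hN i hi)

lemma DepthGE.pi_fin {n : ℕ} (hM : DepthGE A M n) (k : ℕ) : DepthGE A (Fin k → M) n := by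
  induction k with
  | zero => exact fun i hi ↦ ((hM i hi).covariant_of_isRetract ⟨0, 0, Subsingleton.elim _ _⟩)
  | succ k ih =>
    exact (hM.prod ih).of_isRetract (.of_linearEquiv (Fin.consLinearEquiv A fun _ ↦ M).symm)

lemma DepthGE.quotSMulTop {n : ℕ} {x : A} (hx : IsSMulRegular M x) (h : DepthGE A M (n + 1)) :
    DepthGE A (QuotSMulTop x M) n :=
  (h.mono n.le_succ).right (f := LinearMap.lsmul A M x) hx (Submodule.mkQ_surjective _)
    (LinearMap.exact_lsmul_mkQ_smul_top M x) h

lemma depthGE_zero : DepthGE A M 0 := fun _ h ↦ absurd h (Nat.not_lt_zero _)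

lemma support_residueField :
    Module.support A (ResidueField A) = PrimeSpectrum.zeroLocus (maximalIdeal A : Set A) := by
  rw [Module.support_eq_zeroLocus]
  exact congrArg (fun I : Ideal A ↦ PrimeSpectrum.zeroLocus (I : Set A)) Ideal.annihilator_quotient

lemma maximalIdeal_smul_top_lt [Module.Finite A M] [Nontrivial M] : maximalIdeal A • (⊤ : Submodule A M) < ⊤ :=
  (Submodule.top_ne_ideal_smul_of_le_jacobson_annihilator
    (IsLocalRing.maximalIdeal_le_jacobson _)).symm.lt_top

variable [IsNoetherianRing A]

lemma depthGE_one_of_not_isAssociatedPrime (h : ¬ IsAssociatedPrime (maximalIdeal A) M) :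
    DepthGE A M 1 := by
  intro i hi
  obtain rfl : i = 0 := by omega
  refine extZero_zero_iff.mpr (subsingleton_of_forall_eq 0 fun φ ↦ ?_)
  by_contra hφ
  have h1 : φ (residue A 1) ≠ 0 := by
    intro h0
    refine hφ (LinearMap.ext fun z ↦ ?_)
    obtain ⟨r, rfl⟩ := residue_surjective z
    have : residue A r = r • residue A 1 := by
      rw [Algebra.smul_def, map_one, mul_one]; rfl
    rw [this, map_smul, h0, smul_zero, LinearMap.zero_apply]
  refine h (isAssociatedPrime_iff.mpr ⟨inferInstance, φ (residue A 1), ?_⟩)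
  refine ((maximalIdeal.isMaximal A).eq_of_le ?_ ?_)
  · rw [Ne, Ideal.eq_top_iff_one, Submodule.mem_colon_singleton, one_smul, Submodule.mem_bot]
    exact h1
  · intro r hr
    rw [Submodule.mem_colon_singleton, Submodule.mem_bot, ← map_smul, Algebra.smul_def, map_one,
      mul_one, show algebraMap A (ResidueField A) r = 0 from (residue_eq_zero_iff r).mpr hr,
      map_zero]

variable [Module.Finite A M]

lemma DepthGE.exists_isSMulRegular {n : ℕ} (h : DepthGE A M (n + 1)) :
    ∃ x ∈ maximalIdeal A, IsSMulRegular M x := by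
  have := extZero_zero_iff.mp (h 0 n.succ_pos)
  obtain ⟨x, hx, hreg⟩ := IsSMulRegular.subsingleton_linearMap_iff.mp this
  refine ⟨x, ?_, hreg⟩
  rwa [show Module.annihilator A (ResidueField A) = maximalIdeal A from
    Ideal.annihilator_quotient] at hx

/-- Rees's characterization of depth, tested on the residue field. -/
lemma depthGE_iff_exists_isRegular [Nontrivial M] {n : ℕ} :
    DepthGE A M n ↔ ∃ rs : List A, rs.length = n ∧ (∀ r ∈ rs, r ∈ maximalIdeal A) ∧
      RingTheory.Sequence.IsRegular M rs := by
  have : Module.Finite A (ModuleCat.of A (ResidueField A)) :=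
    inferInstanceAs (Module.Finite A (ResidueField A))
  constructor
  · intro h
    exact ModuleCat.exists_isRegular_of_exists_subsingleton_ext (maximalIdeal A) n
      (ModuleCat.of A M) maximalIdeal_smul_top_lt (ModuleCat.of A (ResidueField A))
      support_residueField h
  · rintro ⟨rs, rfl, hrs, hreg⟩
    exact ModuleCat.subsingleton_ext_of_exists_isRegular (maximalIdeal A)
      (ModuleCat.of A (ResidueField A)) support_residueField.subset
      (ModuleCat.of A M) maximalIdeal_smul_top_lt rs hrs hreg

/-- Ischebeck's inequality `depth K ≤ dim A/q` for associated primes `q` of `K`. -/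
lemma DepthGE.le_coheight {c : ℕ} : ∀ {K : Type u} [AddCommGroup K] [Module A K]
    [Module.Finite A K], DepthGE A K c → ∀ {q : PrimeSpectrum A},
    IsAssociatedPrime q.asIdeal K → (c : ℕ∞) ≤ Order.coheight q := by
  induction c with
  | zero => simp
  | succ c ih =>
    intro K _ _ _ hK q hq
    obtain ⟨x, hxm, hx⟩ := hK.exists_isSMulRegular
    obtain ⟨-, z, hz⟩ := isAssociatedPrime_iff.mp hq
    have hz0 : z ≠ 0 := by
      rintro rfl
      exact q.2.ne_top (hz.trans (by simp))
    set T := Submodule.torsionBySet A K q.asIdeal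
    have hT (t : K) : t ∈ T ↔ ∀ a ∈ q.asIdeal, a • t = 0 := by
      simp [T, Submodule.mem_torsionBySet_iff]
    have hzT : z ∈ T := (hT z).mpr fun a ha ↦ by
      rwa [hz, Submodule.mem_colon_singleton, Submodule.mem_bot] at ha
    -- If `T ⊆ xK`, regularity of `x` gives `T = xT`, so `T = 0` by Nakayama. Hence some `t` killed
    -- by `q` survives in `K/xK`, where an associated prime contains both `q` and `x` and is
    -- strictly larger than `q`.
    obtain ⟨t, htT, htx⟩ : ∃ t ∈ T, ∀ s : K, t ≠ x • s := by
      by_contra! hcon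
      have : T = ⊥ := by
        refine Submodule.eq_bot_of_le_smul_of_le_jacobson_bot (Ideal.span {x}) T
          (IsNoetherian.noetherian T) (fun t ht ↦ ?_) ?_
        · obtain ⟨s, rfl⟩ := hcon t ht
          refine Submodule.smul_mem_smul (Ideal.mem_span_singleton_self x) ((hT s).mpr fun a ha ↦ ?_)
          apply hx
          simp only
          rw [smul_zero, smul_comm]
          exact (hT _).mp ht a ha
        · rw [Ideal.span_singleton_le_iff_mem]
          exact IsLocalRing.maximalIdeal_le_jacobson _ hxm
      exact hz0 (by simpa [this] using hzT)
    have hne : (Submodule.Quotient.mk t : QuotSMulTop x K) ≠ 0 := by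
      rw [Ne, Submodule.Quotient.mk_eq_zero]
      intro hmem
      obtain ⟨s, -, hs⟩ := (Submodule.mem_smul_pointwise_iff_exists _ _ _).mp hmem
      exact htx s hs.symm
    obtain ⟨P, hP, hle⟩ := exists_le_isAssociatedPrime_of_isNoetherianRing A _ hne
    have hlt : q < ⟨P, hP.isPrime⟩ := by
      refine lt_of_le_of_ne (fun a ha ↦ hle ?_) fun heq ↦ ?_
      · rw [Submodule.mem_colon_singleton, ← Submodule.Quotient.mk_smul, (hT t).mp htT a ha]
        simp
      · have hxP : x ∈ P := hle (by
          rw [Submodule.mem_colon_singleton, ← Submodule.Quotient.mk_smul, Submodule.mem_bot,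
            Submodule.Quotient.mk_eq_zero]
          exact Submodule.smul_mem_pointwise_smul _ _ ⊤ trivial)
        rw [show P = q.asIdeal from (congrArg PrimeSpectrum.asIdeal heq).symm, hz,
          Submodule.mem_colon_singleton, Submodule.mem_bot] at hxP
        exact hz0 (hx (by simpa using hxP))
    push_cast
    exact (add_le_add_left (ih (hK.quotSMulTop hx) (q := ⟨P, hP.isPrime⟩) hP) 1).trans
      (Order.coheight_add_one_le hlt)

variable (A) in
lemma coe_dim : ((dim A : ℕ) : WithBot ℕ∞) = ringKrullDim A := by
  have h1 : ringKrullDim A < ⊤ := ringKrullDim_lt_top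
  have h0 : 0 ≤ ringKrullDim A := ringKrullDim_nonneg_of_nontrivial
  unfold dim
  generalize ringKrullDim A = e at *
  induction e using WithBot.recBotCoe with
  | bot => simp at h0
  | coe e =>
    induction e using ENat.recTopCoe with
    | top => exact absurd h1 (lt_irrefl _)
    | coe n => simp

/-- Rees's theorem translates regular sequences into Ext vanishing; Ischebeck's inequality supplies
the bound of depth by dimension. -/
lemma isMCM_iff : IsMCM A N ↔ Module.Finite A N ∧ Nontrivial N ∧ DepthGE A N (dim A) := by
  constructor
  · rintro ⟨h1, h2, h3⟩
    refine ⟨h1, h2, ?_⟩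
    rw [← coe_dim] at h3
    have h3 : depth A N = (dim A : ℕ) := by exact_mod_cast h3
    by_cases hd : dim A = 0
    · rw [hd]; exact depthGE_zero
    have hlt : ((dim A - 1 : ℕ) : ℕ∞) < depth A N := by
      rw [h3]; exact_mod_cast (by omega : dim A - 1 < dim A)
    simp only [depth, lt_iSup_iff] at hlt
    obtain ⟨rs, ⟨hrs, hreg⟩, hlt⟩ := hlt
    have hlt : dim A - 1 < rs.length := by exact_mod_cast hlt
    exact (depthGE_iff_exists_isRegular.mpr ⟨rs, rfl, hrs, hreg⟩).mono (by omega)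
  · rintro ⟨h1, h2, h3⟩
    refine ⟨h1, h2, ?_⟩
    rw [← coe_dim]
    suffices depth A N = (dim A : ℕ) by rw [this]; rfl
    refine le_antisymm ?_ ?_
    · refine iSup₂_le fun rs hrs ↦ ?_
      have hD := depthGE_iff_exists_isRegular.mpr ⟨rs, rfl, hrs⟩
      obtain ⟨q, hq⟩ := associatedPrimes.nonempty A N
      have h4 := (hD.le_coheight (q := ⟨q, hq.isPrime⟩) hq)
      have h5 := Order.coheight_le_krullDim (⟨q, hq.isPrime⟩ : PrimeSpectrum A)
      have h6 : ((rs.length : ℕ∞) : WithBot ℕ∞) ≤ (dim A : ℕ) := by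
        rw [coe_dim]
        exact (WithBot.coe_le_coe.mpr h4).trans h5
      exact_mod_cast h6
    · obtain ⟨rs, hlen, hrs⟩ := depthGE_iff_exists_isRegular.mp h3
      rw [← hlen]
      exact le_iSup₂ (f := fun (rs : List A) (_ : (∀ r ∈ rs, r ∈ maximalIdeal A) ∧
        RingTheory.Sequence.IsRegular N rs) ↦ (rs.length : ℕ∞)) rs hrs

end Depth

/-! ### Ext vanishing and quotients by regular sequences. -/

section ExtQuotient

variable {B : Type u} [CommRing B] {N X : Type u} [AddCommGroup N] [Module B N]
  [AddCommGroup X] [Module B X]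

lemma ExtZero.quotSMulTop {x : B} (hx : IsSMulRegular N x) {i : ℕ} (h : ExtZero B N X i)
    (h' : ExtZero B N X (i + 1)) : ExtZero B (QuotSMulTop x N) X (i + 1) :=
  h.right_of_contravariant (f := LinearMap.lsmul B N x) hx (Submodule.mkQ_surjective _)
    (LinearMap.exact_lsmul_mkQ_smul_top N x) h'

/-- Each regular element raises the vanishing bound by one, through the long exact sequence. -/
lemma extZero_quot_ofList {rs : List B} : ∀ {N : Type u} [AddCommGroup N] [Module B N],
    RingTheory.Sequence.IsWeaklyRegular N rs → ∀ {c : ℕ}, (∀ j > c, ExtZero B N X j) →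
    ∀ j > c + rs.length, ExtZero B (N ⧸ (Ideal.ofList rs • ⊤ : Submodule B N)) X j := by
  induction rs with
  | nil =>
    intro N _ _ _ c h j hj
    refine (h j hj).contravariant_of_isRetract
      (.of_linearEquiv (Submodule.quotEquivOfEqBot _ ?_))
    rw [Ideal.ofList_nil, Submodule.bot_smul]
  | cons x rs ih =>
    intro N _ _ hreg c h j hj
    rw [RingTheory.Sequence.isWeaklyRegular_cons_iff] at hreg
    refine (ih hreg.2 (c := c + 1) (fun i hi ↦ ?_) j
      (by rw [List.length_cons] at hj; omega)).contravariant_of_isRetract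
      (.of_linearEquiv (Submodule.quotOfListConsSMulTopEquivQuotSMulTopInner N x rs))
    obtain ⟨i, rfl⟩ : ∃ k, i = k + 1 := ⟨i - 1, by omega⟩
    exact (h i (by omega)).quotSMulTop hreg.1 (h _ (by omega))

/-- The converse shift is Nakayama's lemma, applied to one regular element at a time. -/
lemma extZero_of_extZero_quot_ofList [IsLocalRing B] [IsNoetherianRing B] [Module.Finite B X]
    {rs : List B} (hrs : ∀ r ∈ rs, r ∈ maximalIdeal B) :
    ∀ {N : Type u} [AddCommGroup N] [Module B N] [Module.Finite B N],
    RingTheory.Sequence.IsWeaklyRegular N rs → ∀ {c : ℕ},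
    (∀ j > c + rs.length, ExtZero B (N ⧸ (Ideal.ofList rs • ⊤ : Submodule B N)) X j) →
    ∀ j > c, ExtZero B N X j := by
  induction rs with
  | nil =>
    intro N _ _ _ _ c h j hj
    refine (h j hj).contravariant_of_isRetract
      (.of_linearEquiv (Submodule.quotEquivOfEqBot _ ?_).symm)
    rw [Ideal.ofList_nil, Submodule.bot_smul]
  | cons x rs ih =>
    intro N _ _ _ hreg c h j hj
    rw [RingTheory.Sequence.isWeaklyRegular_cons_iff] at hreg
    refine extZero_of_isSMulRegular (hrs x List.mem_cons_self) hreg.1 ?_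
    refine ih (fun r hr ↦ hrs r (List.mem_cons_of_mem _ hr)) hreg.2 (c := c + 1) (fun i hi ↦ ?_)
      (j + 1) (by omega)
    refine (h i (by rw [List.length_cons]; omega)).contravariant_of_isRetract
      (.of_linearEquiv (Submodule.quotOfListConsSMulTopEquivQuotSMulTopInner N x rs).symm)

lemma exists_injective_of_colon_eq {I : Ideal B} {z : N} (hz : (⊥ : Submodule B N).colon {z} = I) :
    ∃ φ : (B ⧸ I) →ₗ[B] N, Function.Injective φ ∧ φ (Submodule.Quotient.mk 1) = z := by
  have hker : LinearMap.ker (LinearMap.toSpanSingleton B N z) = I := by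
    rw [← hz]
    ext r
    simp [Submodule.mem_colon_singleton]
  refine ⟨I.liftQ (LinearMap.toSpanSingleton B N z) hker.ge, ?_, ?_⟩
  · rw [← LinearMap.ker_eq_bot]
    exact Submodule.ker_liftQ_eq_bot _ _ _ hker.le
  · exact (Submodule.liftQ_apply ..).trans (one_smul B z)

end ExtQuotient

/-! ### Local rings of finite injective dimension. -/

section InjectiveDimension

variable {B : Type u} [CommRing B] [IsLocalRing B] [IsNoetherianRing B]

/-- Over a local ring of finite injective dimension, the vanishing of `Ext^j(-, B)` for `j > r`
can be tested on one module having the maximal ideal as an associated prime. -/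
lemma extZero_of_isAssociatedPrime {n : ℕ} [HasInjectiveDimensionLE (ModuleCat.of B B) n]
    {L₀ : Type u} [AddCommGroup L₀] [Module B L₀] [Module.Finite B L₀]
    (hL₀ : IsAssociatedPrime (maximalIdeal B) L₀) {r : ℕ} (h : ∀ j > r, ExtZero B L₀ B j)
    {L : Type u} [AddCommGroup L] [Module B L] [Module.Finite B L] {j : ℕ} (hj : r < j) :
    ExtZero B L B j := by
  -- Descending induction on `j`, starting above the injective dimension. The residue field embeds
  -- in `L₀`, which handles it; prime filtrations reduce the rest to `B/p`, and for non-maximal `p`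
  -- a nonzerodivisor in the maximal ideal passes to degree `j + 1`.
  suffices H : ∀ t j, r < j → n < j + t → ∀ (L : Type u) [AddCommGroup L] [Module B L],
      Module.Finite B L → ExtZero B L B j from H (n + 1) j hj (by omega) L inferInstance
  intro t
  induction t with
  | zero => exact fun j _ hn L _ _ _ ↦ extZero_of_injectiveDimensionLE (n := n) (by omega)
  | succ t ih =>
    intro j hj hn L _ _ hL
    have hk : ExtZero B (B ⧸ maximalIdeal B) B j := by
      obtain ⟨-, z, hz⟩ := isAssociatedPrime_iff.mp hL₀
      obtain ⟨φ, hφ, -⟩ := exists_injective_of_colon_eq hz.symm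
      exact (h j hj).left_of_contravariant hφ (LinearMap.range φ).mkQ_surjective
        (LinearMap.exact_map_mkQ_range φ) (ih (j + 1) (by omega) (by omega) _ inferInstance)
    induction hL using IsNoetherianRing.induction_on_isQuotientEquivQuotientPrime B with
    | subsingleton N =>
      have : Module.Projective B N := inferInstance
      obtain ⟨i, rfl⟩ : ∃ i, j = i + 1 := ⟨j - 1, by omega⟩
      exact extZero_succ_of_projective i
    | quotient N p e =>
      refine ExtZero.contravariant_of_isRetract (.of_linearEquiv e) ?_
      by_cases hp : p.asIdeal = maximalIdeal B
      · rwa [hp]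
      · obtain ⟨x, hxm, hxp⟩ : ∃ x ∈ maximalIdeal B, x ∉ p.asIdeal := by
          by_contra! hcon
          exact hp (((maximalIdeal.isMaximal B).eq_of_le p.2.ne_top hcon).symm)
        refine extZero_of_isSMulRegular hxm (x := x) ?_ (ih (j + 1) (by omega) (by omega) _
          inferInstance)
        intro a b hab
        simp only [Algebra.smul_def] at hab
        exact mul_left_cancel₀ (by
          rwa [Ne, Ideal.Quotient.algebraMap_eq, Ideal.Quotient.eq_zero_iff_mem]) hab
    | exact N₁ N₂ N₃ f g hf hg hfg h₁ h₃ =>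
      exact h₁.middle_of_contravariant hf hg hfg h₃

/-- If `Ext^i(N, B) = 0` for `i ≥ 1` over a local ring `B` of finite injective dimension, then an
element of `N` annihilated exactly by the maximal ideal is detected by a functional. -/
lemma exists_functional_ne_zero {n : ℕ} [HasInjectiveDimensionLE (ModuleCat.of B B) n]
    {N : Type u} [AddCommGroup N] [Module B N] [Module.Finite B N]
    (h : ∀ i, ExtZero B N B (i + 1)) {z : N}
    (hz : (⊥ : Submodule B N).colon {z} = maximalIdeal B) : ∃ ψ : N →ₗ[B] B, ψ z ≠ 0 := by
  have hN : IsAssociatedPrime (maximalIdeal B) N :=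
    isAssociatedPrime_iff.mpr ⟨inferInstance, z, hz.symm⟩
  -- With `N` as test module, `Ext^1(L, B)` vanishes for every finite `L`, so `B` is self-injective.
  have H (L : Type u) [AddCommGroup L] [Module B L] [Module.Finite B L] : ExtZero B L B 1 := by
    refine extZero_of_isAssociatedPrime (n := n) hN (r := 0) (fun j hj ↦ ?_) one_pos
    obtain ⟨i, rfl⟩ : ∃ i, j = i + 1 := ⟨j - 1, by omega⟩
    exact h i
  -- A regular `x` in the maximal ideal would be invertible, since the identity would extend along
  -- multiplication by `x`. Thus the residue field embeds in `B`, and this embedding extends from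
  -- the copy generated by `z` to `N`.
  have hB : IsAssociatedPrime (maximalIdeal B) B := by
    by_contra hcon
    obtain ⟨x, hxm, hx⟩ := (depthGE_one_of_not_isAssociatedPrime hcon).exists_isSMulRegular
    obtain ⟨ψ, hψ⟩ := (H (QuotSMulTop x B)).exists_extend (f := LinearMap.lsmul B B x) hx
      (Submodule.mkQ_surjective _) (LinearMap.exact_lsmul_mkQ_smul_top B x) LinearMap.id
    have h1 : ψ (x • 1) = 1 := LinearMap.congr_fun hψ 1
    rw [map_smul, smul_eq_mul] at h1
    exact (mem_maximalIdeal x).mp hxm (IsUnit.of_mul_eq_one _ h1)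
  obtain ⟨-, b, hb⟩ := isAssociatedPrime_iff.mp hB
  obtain ⟨φ, hφ, hφz⟩ := exists_injective_of_colon_eq hz
  obtain ⟨φ', hφ', hφb⟩ := exists_injective_of_colon_eq hb.symm
  obtain ⟨ψ, hψ⟩ := (H _).exists_extend hφ (LinearMap.range φ).mkQ_surjective
    (LinearMap.exact_map_mkQ_range φ) φ'
  refine ⟨ψ, fun h0 ↦ ?_⟩
  have h1 : φ' (Submodule.Quotient.mk 1) = 0 := by
    rw [← hψ, LinearMap.comp_apply, hφz, h0]
  have h2 := (map_eq_zero_iff φ' hφ').mp h1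
  rw [Submodule.Quotient.mk_eq_zero] at h2
  exact (maximalIdeal.isMaximal B).ne_top ((Ideal.eq_top_iff_one _).mpr h2)

end InjectiveDimension

/-! ### Regular sequences inside a prime, and Ext vanishing after localization. -/

section

variable {A : Type u} [CommRing A] {M N : Type u} [AddCommGroup M] [Module A M] [AddCommGroup N]
  [Module A N]

lemma IsRetract.isWeaklyRegular {rs : List A} : ∀ {M N : Type u} [AddCommGroup M] [Module A M]
    [AddCommGroup N] [Module A N], IsRetract A M N → RingTheory.Sequence.IsWeaklyRegular N rs →
    RingTheory.Sequence.IsWeaklyRegular M rs := by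
  induction rs with
  | nil => intros; exact .nil A _
  | cons x rs ih =>
    rintro M N _ _ _ _ ⟨i, p, hip⟩ h
    rw [RingTheory.Sequence.isWeaklyRegular_cons_iff] at h ⊢
    refine ⟨h.1.of_injective i (LinearMap.injective_of_comp_eq_id _ _ hip),
      ih ⟨QuotSMulTop.map x i, QuotSMulTop.map x p, ?_⟩ h.2⟩
    rw [← QuotSMulTop.map_comp, hip, QuotSMulTop.map_id]

variable [IsNoetherianRing A]

lemma exists_isAssociatedPrime_le [Module.Finite A M] {q : PrimeSpectrum A}
    (hq : q ∈ Module.support A M) :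
    ∃ p : PrimeSpectrum A, IsAssociatedPrime p.asIdeal M ∧ p ≤ q := by
  obtain ⟨p, hp, hpq⟩ := Ideal.exists_minimalPrimes_le (Module.mem_support_iff_of_finite.mp hq)
  exact ⟨⟨p, hp.1.1⟩,
    Module.associatedPrimes.minimalPrimes_annihilator_subset_associatedPrimes A M hp, hpq⟩

lemma mem_support_of_isAssociatedPrime {q : PrimeSpectrum A} (hq : IsAssociatedPrime q.asIdeal M) :
    q ∈ Module.support A M := by
  obtain ⟨-, z, hz⟩ := isAssociatedPrime_iff.mp hq
  refine Module.mem_support_iff_exists_annihilator.mpr ⟨z, ?_⟩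
  rw [Submodule.annihilator_span_singleton]
  intro r hr
  rw [hz, Submodule.mem_colon_singleton]
  simpa using hr

lemma exists_isSMulRegular_or_le_isAssociatedPrime [Module.Finite A M] (p : Ideal A) :
    (∃ x ∈ p, IsSMulRegular M x) ∨ ∃ q : PrimeSpectrum A, IsAssociatedPrime q.asIdeal M ∧
      p ≤ q.asIdeal := by
  by_cases h : (p : Set A) ⊆ ⋃ q ∈ associatedPrimes A M, (q : Set A)
  · obtain ⟨q, hq, hpq⟩ := (Ideal.subset_union_prime_finite (associatedPrimes.finite A M)
      (f := id) 0 0 fun _ h _ _ ↦ h.isPrime).mp h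
    exact .inr ⟨⟨q, hq.isPrime⟩, hq, hpq⟩
  · left
    obtain ⟨x, hxp, hx⟩ := Set.not_subset.mp h
    refine ⟨x, hxp, isSMulRegular_iff_right_eq_zero_of_smul.mpr fun m hm ↦ ?_⟩
    rw [biUnion_associatedPrimes_eq_zero_divisors] at hx
    by_contra hm0
    exact hx ⟨m, hm0, hm⟩

variable [IsLocalRing A]

/-- If `depth K ≥ c ≥ dim K`, then every prime `p` in the support of `K` contains a `K`-regular
sequence over which `p` is minimal. -/
lemma DepthGE.exists_isWeaklyRegular_forall_eq {c : ℕ} : ∀ {K : Type u} [AddCommGroup K]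
    [Module A K] [Module.Finite A K], DepthGE A K c →
    (∀ q ∈ Module.support A K, Order.coheight q ≤ c) → ∀ {p : PrimeSpectrum A},
    p ∈ Module.support A K → ∃ rs : List A, (∀ r ∈ rs, r ∈ p.asIdeal) ∧
      RingTheory.Sequence.IsWeaklyRegular K rs ∧
      ∀ p' ∈ Module.support A K, (∀ r ∈ rs, r ∈ p'.asIdeal) → p' ≤ p → p' = p := by
  induction c with
  | zero =>
    intro K _ _ _ _ hdim p _
    refine ⟨[], by simp, .nil A K, fun p' hp' _ hle ↦ ?_⟩
    have := hdim p' hp'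
    rw [Nat.cast_zero, nonpos_iff_eq_zero, Order.coheight_eq_zero] at this
    exact this.eq_of_le hle
  | succ c ih =>
    intro K _ _ _ hK hdim p hp
    by_cases hmin : ∀ p' ∈ Module.support A K, p' ≤ p → p' = p
    · exact ⟨[], by simp, .nil A K, fun p' hp' _ ↦ hmin p' hp'⟩
    push Not at hmin
    obtain ⟨p', hp', hle, hne⟩ := hmin
    rcases exists_isSMulRegular_or_le_isAssociatedPrime (M := K) p.asIdeal with
      ⟨x, hxp, hx⟩ | ⟨q, hq, hpq⟩
    · have hdim' (q) (hq : q ∈ Module.support A (QuotSMulTop x K)) :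
          Order.coheight q ≤ (c : ℕ∞) := by
        rw [Module.support_quotSMulTop] at hq
        obtain ⟨q', hq', hle'⟩ := exists_isAssociatedPrime_le hq.1
        have hxq : x ∈ q.asIdeal := by simpa using hq.2
        have hlt : q' < q := by
          refine lt_of_le_of_ne hle' ?_
          rintro rfl
          obtain ⟨hpr, z, hz⟩ := isAssociatedPrime_iff.mp hq'
          rw [hz, Submodule.mem_colon_singleton, Submodule.mem_bot] at hxq
          have : z = 0 := hx (by simpa using hxq)
          exact hpr.ne_top (hz.trans (by simp [this]))
        have h1 := (Order.coheight_add_one_le hlt).trans (hdim q' (mem_support_of_isAssociatedPrime hq'))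
        push_cast at h1
        exact (ENat.add_le_add_iff_right ENat.one_ne_top).mp h1
      obtain ⟨rs, hrs, hreg, hm⟩ := ih (K := QuotSMulTop x K) (hK.quotSMulTop hx) hdim' (p := p)
        (by rw [Module.support_quotSMulTop]; exact ⟨hp, by simpa using hxp⟩)
      refine ⟨x :: rs, ?_, ?_, fun p₁ hp₁ h hle ↦ ?_⟩
      · simpa [hxp] using hrs
      · rw [RingTheory.Sequence.isWeaklyRegular_cons_iff]
        exact ⟨hx, hreg⟩
      · simp only [List.mem_cons, forall_eq_or_imp] at h
        refine hm p₁ ?_ h.2 hle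
        rw [Module.support_quotSMulTop]
        exact ⟨hp₁, by simpa using h.1⟩
    -- An associated prime `q` containing `p` has coheight at least `c + 1`; then `p' < q` would
    -- have coheight at least `c + 2`, against the dimension bound.
    · exfalso
      have h1 := hK.le_coheight hq
      have h2 := (Order.coheight_add_one_le (lt_of_lt_of_le (lt_of_le_of_ne hle hne) hpq)).trans
        (hdim p' hp')
      have h3 : ((c + 1 : ℕ) : ℕ∞) + 1 ≤ (c + 1 : ℕ) := (add_le_add_left h1 1).trans h2
      exact absurd h3 (by norm_cast; omega)

/-- The vanishing of `Ext^i(M_p, A_p)` for `i ≥ 1` and all primes `p` different from the maximal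
ideal. -/
def LocExtVanish (A : Type u) [CommRing A] [IsLocalRing A] (M : Type u) [AddCommGroup M]
    [Module A M] : Prop :=
  ∀ (p : Ideal A) [p.IsPrime], p ≠ maximalIdeal A → ∀ i : ℕ, ExtZero (Localization.AtPrime p)
    (LocalizedModule p.primeCompl M) (Localization.AtPrime p) (i + 1)

/-- A common regular sequence on `M` and `A`, of length `r` and with `p` minimal over it, makes
`A_p` modulo the sequence a test module, so `Ext^j(-, A_p) = 0` for `j > r` on finite modules.
Applied to `M_p` modulo the sequence, this gives vanishing for `M_p` itself in all positive degrees.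
-/
lemma extZero_localization_of_depthGE [Module.Finite A M] (hA : DepthGE A A (dim A))
    (hM : DepthGE A M (dim A)) (p : Ideal A) [hp : p.IsPrime] {n : ℕ}
    [HasInjectiveDimensionLE
      (ModuleCat.of (Localization.AtPrime p) (Localization.AtPrime p)) n] (i : ℕ) :
    ExtZero (Localization.AtPrime p) (LocalizedModule p.primeCompl M)
      (Localization.AtPrime p) (i + 1) := by
  have hsupp (q : PrimeSpectrum A) : q ∈ Module.support A (M × A) := by
    refine Module.support_subset_of_injective (LinearMap.inr A M A) LinearMap.inr_injective ?_
    rw [Module.mem_support_iff_of_finite, Module.annihilator_eq_bot.mpr inferInstance]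
    exact bot_le
  -- Working with `M × A` gives one sequence regular on both factors, and a module supported on the
  -- whole spectrum.
  obtain ⟨rs, hrs, hreg, hmin⟩ := (hM.prod hA).exists_isWeaklyRegular_forall_eq (fun q _ ↦ by
    have := Order.coheight_le_krullDim q
    rw [show Order.krullDim (PrimeSpectrum A) = ringKrullDim A from rfl, ← coe_dim] at this
    exact_mod_cast this) (hsupp ⟨p, hp⟩)
  let B := Localization.AtPrime p
  have : IsNoetherianRing B := IsLocalization.isNoetherianRing p.primeCompl B inferInstance
  have hregM : RingTheory.Sequence.IsWeaklyRegular (LocalizedModule p.primeCompl M)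
      (rs.map (algebraMap A B)) :=
    (IsRetract.isWeaklyRegular ⟨.inl A M A, .fst A M A, LinearMap.fst_comp_inl ..⟩
      hreg).of_isLocalizedModule B p.primeCompl (LocalizedModule.mkLinearMap p.primeCompl M)
  have hregB : RingTheory.Sequence.IsWeaklyRegular B (rs.map (algebraMap A B)) :=
    (IsRetract.isWeaklyRegular ⟨.inr A M A, .snd A M A, LinearMap.snd_comp_inr ..⟩
      hreg).of_isLocalization B p.primeCompl
  have hmem : ∀ r ∈ rs.map (algebraMap A B), r ∈ maximalIdeal B := by
    intro r hr
    obtain ⟨a, ha, rfl⟩ := List.mem_map.mp hr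
    exact (IsLocalization.AtPrime.to_map_mem_maximal_iff B p a).mpr (hrs a ha)
  set ss := rs.map (algebraMap A B) with hss
  let L₀ := B ⧸ (Ideal.ofList ss • ⊤ : Submodule B B)
  have hnt : Nontrivial L₀ := by
    refine Submodule.Quotient.nontrivial_iff.mpr (Ne.symm ?_)
    refine Submodule.top_ne_ideal_smul_of_le_jacobson_annihilator ?_
    exact (Ideal.span_le.mpr hmem).trans (IsLocalRing.maximalIdeal_le_jacobson _)
  -- Any associated prime contracts to a prime inside `p` containing `rs`, which is `p` by
  -- minimality.
  have hL₀ : IsAssociatedPrime (maximalIdeal B) L₀ := by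
    obtain ⟨P, hP⟩ := associatedPrimes.nonempty B L₀
    have hP' : P.IsPrime := hP.isPrime
    have hssP : ∀ s ∈ ss, s ∈ P := by
      intro s hs
      refine IsAssociatedPrime.annihilator_le hP ?_
      rw [Submodule.mem_annihilator]
      rintro y -
      obtain ⟨b, rfl⟩ := Submodule.Quotient.mk_surjective _ y
      rw [← Submodule.Quotient.mk_smul, Submodule.Quotient.mk_eq_zero]
      exact Submodule.smul_mem_smul (Ideal.subset_span hs) trivial
    have hPp : (P.comap (algebraMap A B)) ≤ p := by
      exact (Ideal.comap_mono (IsLocalRing.le_maximalIdeal hP'.ne_top)).trans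
        (IsLocalization.AtPrime.under_maximalIdeal B p).le
    have heq := hmin ⟨P.comap (algebraMap A B), inferInstance⟩ (hsupp _)
      (fun r hr ↦ hssP _ (List.mem_map_of_mem hr)) hPp
    have heq : P.comap (algebraMap A B) = p := congrArg PrimeSpectrum.asIdeal heq
    have : P = maximalIdeal B := by
      rw [← IsLocalization.map_under p.primeCompl B P, Ideal.under, heq]
      exact Localization.AtPrime.map_eq_maximalIdeal
    exact this ▸ hP
  refine extZero_of_extZero_quot_ofList hmem hregM (c := 0) (fun j hj ↦ ?_) _ i.succ_pos
  refine extZero_of_isAssociatedPrime (n := n) hL₀ (r := 0 + ss.length) (fun j hj ↦ ?_) hj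
  refine extZero_quot_ofList hregB (fun j hj ↦ ?_) j hj
  obtain ⟨k, rfl⟩ : ∃ k, j = k + 1 := ⟨j - 1, by omega⟩
  exact extZero_succ_of_projective k

end

/-! ### Torsionless modules and pushforwards. -/

section

variable {A : Type u} [CommRing A] [IsNoetherianRing A] {M : Type u}
  [AddCommGroup M] [Module A M] [Module.Finite A M]

lemma exists_lift_of_localization (p : Ideal A) [p.IsPrime]
    (ψ : LocalizedModule p.primeCompl M →ₗ[Localization.AtPrime p] Localization.AtPrime p) :
    ∃ (f : M →ₗ[A] A) (s : p.primeCompl), ∀ x, algebraMap A (Localization.AtPrime p) (f x) =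
      algebraMap A (Localization.AtPrime p) s *
        ψ (LocalizedModule.mkLinearMap p.primeCompl M x) := by
  have : Module.FinitePresentation A M := Module.finitePresentation_of_finite A M
  obtain ⟨f, s, hf⟩ := Module.FinitePresentation.exists_lift_of_isLocalizedModule p.primeCompl
    (Algebra.linearMap A (Localization.AtPrime p))
    (ψ.restrictScalars A ∘ₗ LocalizedModule.mkLinearMap p.primeCompl M)
  refine ⟨f, s, fun x ↦ ?_⟩
  rw [← Algebra.smul_def]
  exact LinearMap.congr_fun hf x

variable [IsLocalRing A]

/-- Positive depth keeps the maximal ideal from being associated to the submodule `T` killed by all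
functionals. At any other associated prime `p` of `T`, the Gorenstein ring `A_p` has a functional
detecting the corresponding element, and it lifts to `A` up to a denominator. -/
lemma exists_linearMap_ne_zero (hG : IsGorensteinOnPuncturedSpectrum A) (hM : DepthGE A M 1)
    (hloc : LocExtVanish A M) {y : M} (hy : y ≠ 0) : ∃ f : M →ₗ[A] A, f y ≠ 0 := by
  by_contra! hcon
  let T : Submodule A M := ⨅ f : M →ₗ[A] A, LinearMap.ker f
  have hT (t : M) : t ∈ T ↔ ∀ f : M →ₗ[A] A, f t = 0 := by simp [T]
  have : Nontrivial T := ⟨⟨⟨y, (hT y).mpr hcon⟩, 0, fun h ↦ hy (congrArg Subtype.val h)⟩⟩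
  obtain ⟨p, hp⟩ := associatedPrimes.nonempty A T
  obtain ⟨hpp, z, hz⟩ := isAssociatedPrime_iff.mp hp
  have hmem (r : A) : r ∈ p ↔ r • (z : M) = 0 := by
    rw [hz, Submodule.mem_colon_singleton, Submodule.mem_bot, ← Submodule.coe_smul,
      ZeroMemClass.coe_eq_zero]
  have hz0 : (z : M) ≠ 0 := fun h ↦
    hpp.ne_top ((Ideal.eq_top_iff_one _).mpr ((hmem 1).mpr (by rw [h, smul_zero])))
  have hpm : p ≠ maximalIdeal A := by
    rintro rfl
    obtain ⟨x, hxm, hx⟩ := hM.exists_isSMulRegular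
    exact hz0 (hx (by simpa using (hmem x).mp hxm))
  obtain ⟨-, -, n, hn⟩ := hG p hpm
  let B := Localization.AtPrime p
  have : IsNoetherianRing B := IsLocalization.isNoetherianRing p.primeCompl B inferInstance
  let ι := LocalizedModule.mkLinearMap p.primeCompl M
  have hcolon : (⊥ : Submodule B (LocalizedModule p.primeCompl M)).colon {ι z} =
      maximalIdeal B := by
    refine ((maximalIdeal.isMaximal B).eq_of_le ?_ ?_).symm
    · rw [Ne, Ideal.eq_top_iff_one, Submodule.mem_colon_singleton, one_smul, Submodule.mem_bot,
        IsLocalizedModule.eq_zero_iff p.primeCompl ι]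
      rintro ⟨s, hs⟩
      exact s.2 ((hmem s).mpr hs)
    · rw [← Localization.AtPrime.map_eq_maximalIdeal, Ideal.map_le_iff_le_comap]
      intro r hr
      rw [Ideal.mem_comap, Submodule.mem_colon_singleton, Submodule.mem_bot, algebraMap_smul,
        ← map_smul, (hmem r).mp hr, map_zero]
  obtain ⟨ψ, hψ⟩ := exists_functional_ne_zero (n := n) (fun i ↦ hloc p hpm i) hcolon
  obtain ⟨f, s, hf⟩ := exists_lift_of_localization p ψ
  have h0 := hf z
  rw [(hT z).mp z.2 f, map_zero, eq_comm,
    (IsLocalization.map_units B s).mul_right_eq_zero] at h0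
  exact hψ h0

/-- A module of positive depth that satisfies `LocExtVanish` embeds in a free module with a cokernel that is again such. -/
lemma exists_pushforward (hG : IsGorensteinOnPuncturedSpectrum A) (hM : DepthGE A M 1)
    (hloc : LocExtVanish A M) :
    ∃ (n : ℕ) (C : Type u) (_ : AddCommGroup C) (_ : Module A C) (f : M →ₗ[A] (Fin n → A))
      (g : (Fin n → A) →ₗ[A] C), Function.Injective f ∧ Function.Surjective g ∧
      Function.Exact f g ∧ LocExtVanish A C := by
  -- Using generators of the dual as coordinates makes every functional on `M` extend along `f`;
  -- this is what kills `Ext^1` of the localized cokernel.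
  obtain ⟨n, s, hs⟩ := Module.Finite.exists_fin (R := A) (M := M →ₗ[A] A)
  let f : M →ₗ[A] (Fin n → A) := LinearMap.pi s
  have hext (φ : M →ₗ[A] A) : ∃ g : (Fin n → A) →ₗ[A] A, g ∘ₗ f = φ := by
    obtain ⟨c, hc⟩ := (Submodule.mem_span_range_iff_exists_fun A).mp
      (show φ ∈ Submodule.span A (Set.range s) by rw [hs]; trivial)
    refine ⟨∑ i, c i • LinearMap.proj i, ?_⟩
    rw [← hc]
    ext x
    simp [f]
  have hf : Function.Injective f := by
    rw [injective_iff_map_eq_zero]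
    intro y hy
    by_contra hy0
    obtain ⟨φ, hφ⟩ := exists_linearMap_ne_zero hG hM hloc hy0
    obtain ⟨g, rfl⟩ := hext φ
    exact hφ (by rw [LinearMap.comp_apply, hy, map_zero])
  refine ⟨n, (Fin n → A) ⧸ LinearMap.range f, inferInstance, inferInstance, f,
    (LinearMap.range f).mkQ, hf, Submodule.mkQ_surjective _, LinearMap.exact_map_mkQ_range f, ?_⟩
  intro p _ hp i
  let B := Localization.AtPrime p
  have hexact : Function.Exact (LocalizedModule.map p.primeCompl f)
    (LocalizedModule.map p.primeCompl (LinearMap.range f).mkQ) :=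
    LocalizedModule.map_exact p.primeCompl _ _ (LinearMap.exact_map_mkQ_range f)
  have hinj := LocalizedModule.map_injective p.primeCompl f hf
  have hsurj := LocalizedModule.map_surjective p.primeCompl _ (LinearMap.range f).mkQ_surjective
  cases i with
  | succ i =>
    exact (hloc p hp i).right_of_contravariant hinj hsurj hexact (extZero_succ_of_projective _)
  | zero =>
    refine ExtZero.right_one_of_forall_exists_extend hinj hsurj hexact (fun ψ ↦ ?_)
      (extZero_succ_of_projective _)
    obtain ⟨φ, s, hφ⟩ := exists_lift_of_localization p ψ
    obtain ⟨g, rfl⟩ := hext φ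
    obtain ⟨u, hu⟩ := IsLocalization.map_units B s
    let ε : LocalizedModule p.primeCompl A →ₗ[B] B :=
      ((IsLocalizedModule.linearEquiv p.primeCompl (LocalizedModule.mkLinearMap p.primeCompl A)
        (Algebra.linearMap A B)).toLinearMap).extendScalarsOfIsLocalization p.primeCompl B
    have hε (a : A) : ε (LocalizedModule.mkLinearMap p.primeCompl A a) = algebraMap A B a :=
      IsLocalizedModule.linearEquiv_apply p.primeCompl _ _ a
    refine ⟨(↑u⁻¹ : B) • (ε ∘ₗ LocalizedModule.map p.primeCompl g), ?_⟩
    refine LinearMap.restrictScalars_injective A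
      (IsLocalizedModule.linearMap_ext p.primeCompl (LocalizedModule.mkLinearMap p.primeCompl M)
        (Algebra.linearMap A B) (LinearMap.ext fun x ↦ ?_))
    have h1 : LocalizedModule.map p.primeCompl g (LocalizedModule.map p.primeCompl f
        (LocalizedModule.mkLinearMap p.primeCompl M x)) =
        LocalizedModule.mkLinearMap p.primeCompl A (g (f x)) := by
      simp [LocalizedModule.mkLinearMap_apply, LocalizedModule.map_mk]
    change (↑u⁻¹ : B) • ε (LocalizedModule.map p.primeCompl g (LocalizedModule.map p.primeCompl f
        (LocalizedModule.mkLinearMap p.primeCompl M x))) =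
        ψ (LocalizedModule.mkLinearMap p.primeCompl M x)
    rw [h1, hε, show algebraMap A B (g (f x)) = _ from hφ x, ← hu, smul_eq_mul,
      Units.inv_mul_cancel_left]

end

/-! ### Multiplicity under surjections and base change. -/

section Multiplicity

variable {R : Type u} [CommRing R] [IsLocalRing R]

lemma hsMultiplicity_le_of_surjective {M N : Type u} [AddCommGroup M] [Module R M]
    [AddCommGroup N] [Module R N] (f : M →ₗ[R] N) (hf : Function.Surjective f) :
    hsMultiplicity R N ≤ hsMultiplicity R M := by
  refine Filter.limsup_le_limsup (.of_forall fun n ↦ ?_)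
  have : Module.length R (N ⧸ (maximalIdeal R ^ n • ⊤ : Submodule R N)) ≤
      Module.length R (M ⧸ (maximalIdeal R ^ n • ⊤ : Submodule R M)) :=
    Module.length_le_of_surjective
      (Submodule.mapQ _ _ f (Submodule.smul_top_le_comap_smul_top _ f))
      fun q ↦ by
        obtain ⟨x, rfl⟩ := Submodule.Quotient.mk_surjective _ q
        obtain ⟨y, rfl⟩ := hf x
        exact ⟨Submodule.Quotient.mk y, Submodule.mapQ_apply ..⟩
  dsimp only
  gcongr

lemma IsRetract.hsMultiplicity_le {M N : Type u} [AddCommGroup M] [Module R M]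
    [AddCommGroup N] [Module R N] (h : IsRetract R M N) :
    hsMultiplicity R M ≤ hsMultiplicity R N := by
  obtain ⟨i, p, hip⟩ := h
  exact hsMultiplicity_le_of_surjective p (LinearMap.surjective_of_comp_eq_id _ _ hip)

variable {S : Type u} [CommRing S] [IsLocalRing S] [Algebra R S]

/-- Flatness and `𝔪S = 𝔫` make the length of `S ⊗ (N/𝔪^n N)` over `S` equal to that of `N/𝔪^n N`
over `R`, and this module surjects onto the quotient of `S ⊗ N` by `𝔫^n`. -/
lemma hsMultiplicity_tensorProduct_le [IsLocalHom (algebraMap R S)] [Module.Flat R S]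
    (hmax : (maximalIdeal R).map (algebraMap R S) = maximalIdeal S) (hdim : dim S = dim R)
    (N : Type u) [AddCommGroup N] [Module R N] :
    hsMultiplicity S (S ⊗[R] N) ≤ hsMultiplicity R N := by
  refine Filter.limsup_le_limsup (.of_forall fun n ↦ ?_)
  simp only [hdim]
  suffices Module.length S ((S ⊗[R] N) ⧸ (maximalIdeal S ^ n • ⊤ : Submodule S (S ⊗[R] N))) ≤
      Module.length R (N ⧸ (maximalIdeal R ^ n • ⊤ : Submodule R N)) by gcongr
  have h1 := IsLocalRing.length_baseChange R S (N ⧸ (maximalIdeal R ^ n • ⊤ : Submodule R N))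
  have h2 : Module.length S (S ⧸ maximalIdeal S) = 1 :=
    Module.length_eq_one_iff.mpr (isSimpleModule_iff_isCoatom.mpr (maximalIdeal.isMaximal S).out)
  rw [hmax, h2, mul_one] at h1
  rw [← h1]
  let Q := (S ⊗[R] N) ⧸ (maximalIdeal S ^ n • ⊤ : Submodule S (S ⊗[R] N))
  let π : S ⊗[R] N →ₗ[S] Q := Submodule.mkQ _
  let g : N →ₗ[R] Q := π.restrictScalars R ∘ₗ TensorProduct.mk R S N 1
  have hg : (maximalIdeal R ^ n • ⊤ : Submodule R N) ≤ LinearMap.ker g := by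
    refine Submodule.smul_le.mpr fun r hr x _ ↦ ?_
    rw [LinearMap.mem_ker, map_smul, ← algebraMap_smul S r (g x)]
    change algebraMap R S r • π (1 ⊗ₜ x) = 0
    rw [← map_smul]
    refine (Submodule.Quotient.mk_eq_zero _).mpr (Submodule.smul_mem_smul ?_ trivial)
    rw [← hmax, ← Ideal.map_pow]
    exact Ideal.mem_map_of_mem _ hr
  refine Module.length_le_of_surjective
    (LinearMap.liftBaseChange S (Submodule.liftQ _ g hg)) fun q ↦ ?_
  obtain ⟨t, rfl⟩ := Submodule.Quotient.mk_surjective _ q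
  induction t using TensorProduct.induction_on with
  | zero => exact ⟨0, map_zero _⟩
  | tmul s x =>
    refine ⟨s ⊗ₜ Submodule.Quotient.mk x, ?_⟩
    rw [LinearMap.liftBaseChange_tmul]
    change s • π (1 ⊗ₜ x) = π (s ⊗ₜ x)
    rw [← map_smul, TensorProduct.smul_tmul', smul_eq_mul, mul_one]
  | add a b ha hb =>
    obtain ⟨a', ha⟩ := ha
    obtain ⟨b', hb⟩ := hb
    exact ⟨a' + b', by rw [map_add, ha, hb, Submodule.Quotient.mk_add]⟩

end Multiplicity

/-! ### Dimension and Cohen–Macaulayness under base change. -/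

section Dimension

lemma isCMLocalRing_iff {A : Type u} [CommRing A] [IsLocalRing A] [IsNoetherianRing A] :
    IsCMLocalRing A ↔ DepthGE A A (dim A) :=
  ⟨fun h ↦ (isMCM_iff.mp ⟨inferInstance, inferInstance, h.depth_eq⟩).2.2,
    fun h ↦ ⟨inferInstance, (isMCM_iff.mpr ⟨inferInstance, inferInstance, h⟩).depth_eq⟩⟩

variable {R S : Type u} [CommRing R] [IsLocalRing R] [IsNoetherianRing R] [CommRing S]
  [IsLocalRing S] [IsNoetherianRing S] [Algebra R S] [Module.FaithfullyFlat R S]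

/-- A flat local homomorphism with `𝔪S = 𝔫` preserves the dimension and the Cohen–Macaulay
property. -/
lemma dim_eq_and_depthGE [IsLocalHom (algebraMap R S)]
    (hmax : (maximalIdeal R).map (algebraMap R S) = maximalIdeal S) (hR : DepthGE R R (dim R)) :
    dim S = dim R ∧ DepthGE S S (dim S) := by
  obtain ⟨rs, hlen, hrs, hreg⟩ := depthGE_iff_exists_isRegular.mp hR
  have hregS := hreg.of_faithfullyFlat (S := S)
  have h1 := ringKrullDim_add_length_eq_ringKrullDim_of_isRegular _ hreg
  have h2 := ringKrullDim_add_length_eq_ringKrullDim_of_isRegular _ hregS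
  have hmem : ∀ s ∈ rs.map (algebraMap R S), s ∈ maximalIdeal S := by
    intro s hs
    obtain ⟨r, hr, rfl⟩ := List.mem_map.mp hs
    rw [← hmax]
    exact Ideal.mem_map_of_mem _ (hrs r hr)
  have hR' : Nontrivial (R ⧸ Ideal.ofList rs) :=
    Ideal.Quotient.nontrivial_iff.mpr fun h ↦ (maximalIdeal.isMaximal R).ne_top
      (top_le_iff.mp (h.symm.trans_le (Ideal.span_le.mpr hrs)))
  have hS' : Nontrivial (S ⧸ Ideal.ofList (rs.map (algebraMap R S))) :=
    Ideal.Quotient.nontrivial_iff.mpr fun h ↦ (maximalIdeal.isMaximal S).ne_top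
      (top_le_iff.mp (h.symm.trans_le (Ideal.span_le.mpr hmem)))
  have hR0 : Ring.KrullDimLE 0 (R ⧸ Ideal.ofList rs) := by
    rw [ringKrullDimZero_iff_ringKrullDim_eq_zero]
    rw [hlen, ← coe_dim R] at h1
    have h0 : 0 ≤ ringKrullDim (R ⧸ Ideal.ofList rs) := ringKrullDim_nonneg_of_nontrivial
    generalize ringKrullDim (R ⧸ Ideal.ofList rs) = e at h0 h1
    induction e using WithBot.recBotCoe with
    | bot => simp at h0
    | coe e =>
      have h1 : e + (dim R : ℕ) = (0 : ℕ∞) + (dim R : ℕ) := by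
        rw [zero_add]
        exact_mod_cast h1
      rw [(ENat.add_left_injective_of_ne_top (ENat.natCast_ne_top _)) h1]
      rfl
  -- A prime of `S` over the regular sequence contracts to a prime of `R` over it, hence to `𝔪`, and
  -- so contains `𝔪S`, the maximal ideal of `S`.
  have hS0 : Ring.KrullDimLE 0 (S ⧸ Ideal.ofList (rs.map (algebraMap R S))) := by
    rw [Ring.krullDimLE_zero_iff] at hR0 ⊢
    intro P hP
    let π := Ideal.Quotient.mk (Ideal.ofList (rs.map (algebraMap R S)))
    have hrsP : Ideal.ofList rs ≤ (P.comap π).comap (algebraMap R S) := by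
      refine Ideal.span_le.mpr fun r hr ↦ ?_
      change π (algebraMap R S r) ∈ P
      have h3 : algebraMap R S r ∈ Ideal.ofList (rs.map (algebraMap R S)) :=
        Ideal.subset_span (List.mem_map_of_mem hr)
      rw [Ideal.Quotient.eq_zero_iff_mem.mpr h3]
      exact P.zero_mem
    have hq : ((P.comap π).comap (algebraMap R S)).IsMaximal := by
      let ρ := Ideal.Quotient.mk (Ideal.ofList rs)
      have hker : RingHom.ker ρ ≤ (P.comap π).comap (algebraMap R S) := by
        rwa [Ideal.mk_ker]
      have h3 := hR0 (((P.comap π).comap (algebraMap R S)).map ρ)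
        (Ideal.map_isPrime_of_surjective Ideal.Quotient.mk_surjective hker)
      have h4 := Ideal.comap_isMaximal_of_surjective ρ Ideal.Quotient.mk_surjective
        (K := ((P.comap π).comap (algebraMap R S)).map ρ)
      rwa [Ideal.comap_map_of_surjective' _ Ideal.Quotient.mk_surjective, sup_of_le_left hker] at h4
    have hPm : P.comap π = maximalIdeal S := by
      refine ((maximalIdeal.isMaximal S).eq_of_le (Ideal.IsPrime.ne_top inferInstance) ?_).symm
      rw [← hmax, Ideal.map_le_iff_le_comap, eq_maximalIdeal hq]
    have : (P.comap π).IsMaximal := hPm ▸ maximalIdeal.isMaximal S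
    rw [← Ideal.map_comap_of_surjective π Ideal.Quotient.mk_surjective P]
    exact (Ideal.map_eq_top_or_isMaximal_of_surjective π Ideal.Quotient.mk_surjective
      this).resolve_left (by
        rw [Ideal.map_comap_of_surjective π Ideal.Quotient.mk_surjective P]; exact hP.ne_top)
  rw [ringKrullDimZero_iff_ringKrullDim_eq_zero] at hS0
  have hdim : dim S = dim R := by
    rw [hS0, zero_add, List.length_map, hlen, ← coe_dim S] at h2
    exact_mod_cast h2.symm
  refine ⟨hdim, depthGE_iff_exists_isRegular.mpr ⟨_, ?_, hmem, hregS⟩⟩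
  rw [List.length_map, hlen, hdim]

end Dimension

/-! ### Schanuel's lemma for retracts. -/

section Schanuel

variable {A : Type*} [CommRing A] {M F C V G W X : Type*} [AddCommGroup M] [Module A M]
  [AddCommGroup F] [Module A F] [AddCommGroup C] [Module A C] [AddCommGroup V] [Module A V]
  [AddCommGroup G] [Module A G] [AddCommGroup W] [Module A W] [AddCommGroup X] [Module A X]

lemma exists_comp_eq_of_exact {f : M →ₗ[A] F} {g : F →ₗ[A] C} (hf : Function.Injective f)
    (hfg : Function.Exact f g) {φ : X →ₗ[A] F} (hφ : g ∘ₗ φ = 0) :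
    ∃ ψ : X →ₗ[A] M, f ∘ₗ ψ = φ := by
  have hmem (x : X) : φ x ∈ LinearMap.range f := (hfg (φ x)).mp (LinearMap.congr_fun hφ x)
  refine ⟨(LinearEquiv.ofInjective f hf).symm.toLinearMap ∘ₗ φ.codRestrict _ hmem, ?_⟩
  ext x
  exact congrArg Subtype.val
    ((LinearEquiv.ofInjective f hf).apply_symm_apply (φ.codRestrict _ hmem x))

/-- A form of Schanuel's lemma for retracts. -/
lemma IsRetract.of_exact [Module.Projective A F] [Module.Projective A G]
    {f : M →ₗ[A] F} {g : F →ₗ[A] C} (hf : Function.Injective f) (hg : Function.Surjective g)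
    (hfg : Function.Exact f g) {κ : V →ₗ[A] G} {π : G →ₗ[A] W} (hκ : Function.Injective κ)
    (hπ : Function.Surjective π) (hκπ : Function.Exact κ π) (h : IsRetract A C W) :
    IsRetract A M (V × F) := by
  obtain ⟨i, p, hip⟩ := h
  obtain ⟨p', hp'⟩ := Module.projective_lifting_property g (p ∘ₗ π) hg
  obtain ⟨i', hi'⟩ := Module.projective_lifting_property π (i ∘ₗ g) hπ
  -- The lifts `i'` and `p'` compose to the identity only modulo `M`; the defect `h` is corrected by
  -- the extra summand `F`.
  obtain ⟨h, hh⟩ := exists_comp_eq_of_exact hf hfg (φ := LinearMap.id - p' ∘ₗ i') (by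
    rw [LinearMap.comp_sub, ← LinearMap.comp_assoc, hp', LinearMap.comp_assoc, hi',
      ← LinearMap.comp_assoc, hip, LinearMap.comp_id, LinearMap.id_comp, sub_self])
  obtain ⟨α, hα⟩ := exists_comp_eq_of_exact hκ hκπ (φ := i' ∘ₗ f) (by
    rw [← LinearMap.comp_assoc, hi', LinearMap.comp_assoc, hfg.linearMap_comp_eq_zero,
      LinearMap.comp_zero])
  obtain ⟨β, hβ⟩ := exists_comp_eq_of_exact hf hfg (φ := p' ∘ₗ κ) (by
    rw [← LinearMap.comp_assoc, hp', LinearMap.comp_assoc, hκπ.linearMap_comp_eq_zero,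
      LinearMap.comp_zero])
  refine ⟨α.prod f, β.coprod h, LinearMap.ext fun m ↦ hf ?_⟩
  have h1 := LinearMap.congr_fun hβ (α m)
  have h2 := LinearMap.congr_fun hα m
  have h3 := LinearMap.congr_fun hh (f m)
  simp only [LinearMap.comp_apply, LinearMap.sub_apply, LinearMap.id_apply] at h1 h2 h3
  change f (β (α m) + h (f m)) = f m
  rw [map_add, h1, h2, h3, add_sub_cancel]

end Schanuel

/-! ### Descent to modules over the base ring. -/

section Descent

variable {R S : Type u} [CommRing R] [IsLocalRing R] [IsNoetherianRing R] [CommRing S]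
  [IsLocalRing S] [IsNoetherianRing S] [Algebra R S] [Module.Flat R S]

/-- Modules of depth at least `j` that satisfy `LocExtVanish` are
retracts of extensions of modules of depth at least `j`. -/
lemma exists_isRetract_tensorProduct_depthGE (hét : ∀ a : S, IsEtaleElement R a)
    (hG : IsGorensteinOnPuncturedSpectrum S) {j : ℕ} (hR : DepthGE R R j) (hS : DepthGE S S j)
    (M : Type u) [AddCommGroup M] [Module S M] [Module.Finite S M] (hM : DepthGE S M j)
    (hloc : LocExtVanish S M) :
    ∃ (W : Type u) (_ : AddCommGroup W) (_ : Module R W), Module.Finite R W ∧ DepthGE R W j ∧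
      IsRetract S M (S ⊗[R] W) := by
  induction j generalizing M with
  | zero =>
    obtain ⟨Y, _, _, hY, h⟩ := exists_isRetract_tensorProduct hét M
    exact ⟨Y, _, _, hY, depthGE_zero, h⟩
  -- The cokernel `C` loses one unit of depth, and the syzygy `V` of `W` over `R` regains it.
  -- Schanuel's lemma compares `M` with the extension of `V`, up to the free module `S^n`, which is
  -- itself extended from `R`.
  | succ j ih =>
    obtain ⟨n, C, _, _, f, g, hf, hg, hfg, hC⟩ :=
      exists_pushforward hG (hM.mono (by omega)) hloc
    have : Module.Finite S C := Module.Finite.of_surjective g hg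
    obtain ⟨W, _, _, hW, hWj, hret⟩ := ih (hR.mono j.le_succ) (hS.mono j.le_succ) C
      (((hS.mono j.le_succ).pi_fin n).right hf hg hfg hM) hC
    obtain ⟨m, π, hπ⟩ := Module.Finite.exists_fin' R W
    let V := LinearMap.ker π
    have hexact : Function.Exact V.subtype π := LinearMap.exact_subtype_ker_map π
    refine ⟨V × (Fin n → R), inferInstance, inferInstance, inferInstance,
      (hWj.left V.subtype_injective hπ hexact (hR.pi_fin m)).prod (hR.pi_fin n), ?_⟩
    have hret' := IsRetract.of_exact hf hg hfg (κ := V.subtype.baseChange S)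
      (π := π.baseChange S)
      (Module.Flat.lTensor_preserves_injective_linearMap (M := S) _ V.subtype_injective)
      (LinearMap.lTensor_surjective S hπ) (Module.Flat.lTensor_exact S hexact) hret
    refine hret'.trans (.of_linearEquiv ?_)
    exact ((LinearEquiv.refl S _).prodCongr (TensorProduct.piScalarRight R S S (Fin n)).symm).trans
      (TensorProduct.prodRight R S S V (Fin n → R)).symm

end Descent

/-- If an indecomposable module over a Henselian local ring is a retract of an extended module, then
it is a retract of the extension of an indecomposable module. -/
lemma IsIndecomposable.exists_isRetract_tensorProduct {R S : Type u} [CommRing R]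
    [IsNoetherianRing R] [CommRing S] [HenselianLocalRing S] [IsNoetherianRing S] [Algebra R S]
    {M : Type u}
    [AddCommGroup M] [Module S M] [Module.Finite S M] (hM : IsIndecomposable S M) {W : Type u}
    [AddCommGroup W] [Module R W] [Module.Finite R W] (h : IsRetract S M (S ⊗[R] W)) :
    ∃ (W' : Type u) (_ : AddCommGroup W') (_ : Module R W'), IsRetract R W' W ∧
      IsIndecomposable R W' ∧ IsRetract S M (S ⊗[R] W') := by
  -- Among the retracts of `W` whose extension still has `M` as a retract, one with maximal
  -- projection kernel is chosen; passing to a proper summand would enlarge the kernel.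
  obtain ⟨_, ⟨W', _, _, i, p, hip, hMW, rfl⟩, hmax⟩ := set_has_maximal_iff_noetherian.mpr
    (inferInstanceAs (IsNoetherian R W))
    { K | ∃ (W' : Type u) (_ : AddCommGroup W') (_ : Module R W') (i : W' →ₗ[R] W)
      (p : W →ₗ[R] W'), p ∘ₗ i = LinearMap.id ∧ IsRetract S M (S ⊗[R] W') ∧ LinearMap.ker p = K }
    ⟨⊥, W, _, _, .id, .id, rfl, h, LinearMap.ker_id⟩
  have hpi (x : W') : p (i x) = x := LinearMap.congr_fun hip x
  have := hM.1
  have hnt : Nontrivial (S ⊗[R] W') := hMW.nontrivial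
  have key (N P : Submodule R W') (hNP : IsCompl N P) (hN : IsRetract S M (S ⊗[R] N)) :
      P = ⊥ := by
    have hle : LinearMap.ker p ≤ LinearMap.ker (N.projectionOnto P hNP ∘ₗ p) :=
      LinearMap.ker_le_ker_comp p _
    have heq := hle.eq_of_not_lt (hmax _ ⟨N, inferInstance, inferInstance, i ∘ₗ N.subtype,
      N.projectionOnto P hNP ∘ₗ p, by ext x; simp [hpi], hN, rfl⟩)
    rw [eq_bot_iff]
    intro x hx
    have : i x ∈ LinearMap.ker p := by
      rw [heq, LinearMap.mem_ker, LinearMap.comp_apply, hpi]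
      exact Submodule.projectionOnto_apply_right hNP ⟨x, hx⟩
    rwa [LinearMap.mem_ker, hpi] at this
  refine ⟨W', _, _, ⟨i, p, hip⟩, ⟨?_, fun N P hNP ↦ ?_⟩, hMW⟩
  · by_contra hcon
    have := not_nontrivial_iff_subsingleton.mp hcon
    exact not_subsingleton (S ⊗[R] W') inferInstance
  · have h1 : IsRetract S M ((S ⊗[R] N) × (S ⊗[R] P)) :=
      hMW.trans (.of_linearEquiv (((Submodule.prodEquivOfIsCompl N P hNP).symm.baseChange R S _
        _).trans (TensorProduct.prodRight R S S N P)))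
    exact (hM.isRetract_or_isRetract h1).elim (fun h ↦ .inr (key N P hNP h))
      (fun h ↦ .inl (key P N hNP.symm h))

end BoundedCM

/-! ### The proposition. -/

open BoundedCM

theorem proposition3p2 (R Rh : Type u) [CommRing R] [IsLocalRing R]
    [CommRing Rh] [IsLocalRing Rh] [Algebra R Rh]
    (hR : BoundedCM.IsCMLocalRing R)
    (hRh : BoundedCM.IsHenselization R Rh)
    (hGor : BoundedCM.IsGorensteinOnPuncturedSpectrum Rh)
    (hbdd : BoundedCM.HasBoundedCMType R) :
    BoundedCM.IsCMLocalRing Rh ∧ BoundedCM.HasBoundedCMType Rh := by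
  have := hR.noetherian
  have := hRh.isNoetherianRing
  have := hRh.isLocalHom
  have := hRh.henselianLocalRing
  have := hRh.flat
  have := hRh.faithfullyFlat
  have hRd := isCMLocalRing_iff.mp hR
  obtain ⟨hdim, hS⟩ := dim_eq_and_depthGE hRh.map_maximalIdeal hRd
  refine ⟨isCMLocalRing_iff.mpr hS, ?_⟩
  obtain ⟨B, hB⟩ := hbdd
  -- The bound for `R` works unchanged for the Henselization.
  refine ⟨B, fun M _ _ hM hind ↦ ?_⟩
  obtain ⟨_, _, hMd⟩ := isMCM_iff.mp hM
  have hloc : LocExtVanish Rh M := fun p _ hp i ↦ by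
    obtain ⟨-, -, n, _⟩ := hGor p hp
    exact extZero_localization_of_depthGE hS hMd p (n := n) i
  obtain ⟨W, _, _, _, hWd, hMW⟩ := exists_isRetract_tensorProduct_depthGE
    (fun a ↦ hRh.isEtaleElement a) hGor hRd (hdim ▸ hS) M (hdim ▸ hMd) hloc
  obtain ⟨W', _, _, hW', hind', hMW'⟩ := hind.exists_isRetract_tensorProduct hMW
  have hmcm : IsMCM R W' := isMCM_iff.mpr ⟨hW'.finite, hind'.1, hWd.of_isRetract hW'⟩
  exact hMW'.hsMultiplicity_le.trans <|
    (hsMultiplicity_tensorProduct_le hRh.map_maximalIdeal hdim W').trans (hB W' hmcm hind')
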